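/- Let $L$ be the number of factor matrices and $d_0,\dots,d_L$ the layer sizes of a linear network. Let $\theta=(W_L,\dots,W_1)$ with $W_j\in\mathbb{R}^{d_j\times d_{j-1}}$ be any point of the weight space $\mathbb{R}^{d_\theta}$, $d_\theta=\sum_{j=1}^L d_jd_{j-1}$, and let $\mathrm{d}\mu(\theta)$ be the differential at $\theta$ of the matrix multiplication map $\mu(W_L,\dots,W_1)=W_L\cdots W_1$. Notation. For $L\ge k\ge i\ge 0$ put $W_{k\sim i}=W_kW_{k-1}\cdots W_{i+1}$, with $W_{i\sim i}=I$, $W_{L+1\sim i}=0$ and $W_{j\sim -1}=0$. Let $$A_{kji}=\mathrm{null}\,W_{k+1\sim j}\cap\mathrm{col}\,W_{j\sim i}\quad(k\in[j-1,L],\ i\in[-1,j]),$$ $$B_{kji}=\mathrm{row}\,W_{k\sim j}\cap\mathrm{null}\,W_{j\sim i-1}^\top\quad(k\in[j,L+1],\ i\in[0,j+1]).$$ For subspaces $Y\subseteq Z$ let $Z\downarrow Y$ be the set of subspaces $X$ with $Z=X\oplus Y$. For subspaces $U,V$ let $U\otimes V$ be the space of matrices $M$ with $\mathrm{col}\,M\subseteq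 U$ and $\mathrm{row}\,M\subseteq V$. For $L\ge k\ge j\ge i\ge 0$ let $$a_{kji}\in A_{kji}\downarrow(A_{k,j,i-1}+A_{k-1,j,i}),\qquad b_{kji}\in B_{kji}\downarrow(B_{k,j,i+1}+B_{k+1,j,i})$$ be any flow prebasis subspaces, that is, subspaces chosen such that $a_{kji}=W_ja_{k,j-1,i}$ and $b_{k,j-1,i}=W_j^\top b_{kji}$ whenever $L\ge k\ge j>i\ge 0$. One-matrix subspaces: for $L\ge l\ge j\ge i\ge 0$ and $L\ge k\ge j-1\ge h\ge 0$, $\phi_{lkjih}$ is the set of weight vectors whose entry in the place of $W_j$ is some $M\in a_{lji}\otimes b_{k,j-1,h}$ and whose other entries are $0$. Two-matrix subspaces: for $L\ge l>j>h\ge 0$ and $L\ge k\ge j\ge i\ge 0$, $$\tau_{lkjih}=\{(0,\dots,0,W_{j+1}H,-HW_j,0,\dots,0):H\in a_{lji}\otimes b_{kjh}\},$$ with the nonzero entries in the places of $W_{j+1}$ and $W_j$. Let $\Theta_{\mathrm O}$ be the set of all $\phi_{lkjih}\ne\{0\}$ and $\Theta_{\mathrm T}$ the set of all $\tau_{lkjih}\neq\{0\}$,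 with indices as above. Let $\Theta_{\mathrm O}^{L0}$, $\Theta_{\mathrm T}^{L0}$ be their members with $l=L$ and $h=0$, and $\Theta_{\mathrm O}^{\mathrm{comb}}$, $\Theta_{\mathrm T}^{\mathrm{comb}}$ their members with $l>k$ and $i>h$. Define the freedom prebasis, the stratum prebasis and the fiber prebasis by $$\Theta^{\mathrm{free}}=(\Theta_{\mathrm O}\setminus\Theta_{\mathrm O}^{L0})\cup\Theta_{\mathrm T}^{L0},\qquad \Theta^{\mathrm{stratum}}=(\Theta_{\mathrm O}\setminus\Theta_{\mathrm O}^{L0}\setminus\Theta_{\mathrm O}^{\mathrm{comb}})\cup\Theta_{\mathrm T}^{L0}\cup\Theta_{\mathrm T}^{\mathrm{comb}},$$ $$\Theta^{\mathrm{fiber}}=\Theta^{\mathrm{stratum}}\cup\{\phi_{l,k,k+1,i,h}\in\Theta_{\mathrm O}:(L>l\text{ or }h>0),\ l>k,\ i>h\}.$$ Theorem. $\Theta^{\mathrm{free}}$ is a prebasis for $\mathrm{null}\,\mathrm{d}\mu(\theta)$, and so is $\Theta^{\mathrm{fiber}}$: in each of the two sets, every member meets the sum of the other members only in $0$, and the members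 together span $\mathrm{null}\,\mathrm{d}\mu(\theta)$. Moreover, $$\dim\mathrm{null}\,\mathrm{d}\mu(\theta)=d_\theta-\sum_{j=1}^{L}\mathrm{rk}\,W_{L\sim j}\cdot\mathrm{rk}\,W_{j-1\sim 0}+\sum_{j=1}^{L-1}\mathrm{rk}\,W_{L\sim j}\cdot\mathrm{rk}\,W_{j\sim 0}.$$ -/

import Mathlib

/-- The weight space of a linear network with `L` matrices and unit layers of sizes
`d 0, …, d L`. The entry `θ m`, for `m = 0, …, L - 1`, is the factor matrix `W_{m+1}`, of size
`d (m+1) × d m`. -/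
abbrev WeightSpace (L : ℕ) (d : ℕ → ℕ) : Type :=
  (m : Fin L) → Matrix (Fin (d (m + 1))) (Fin (d m)) ℝ

/-- The factor matrix `W_{m+1}`, extended by `0` beyond the last layer (so `W_{L+1} = 0`). -/
def factorMat {L : ℕ} {d : ℕ → ℕ} (θ : WeightSpace L d) (m : ℕ) :
    Matrix (Fin (d (m + 1))) (Fin (d m)) ℝ :=
  if h : m < L then θ ⟨m, h⟩ else 0

/-- The subsequence matrix `W_{k∼i} = W_k W_{k-1} ⋯ W_{i+1}` for `k ≥ i`, with `W_{i∼i} = 1`.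
For `k = L + 1` and `i ≤ L` it is `0`. (The value for `k < i` is not used.) -/
def subseqMat {L : ℕ} {d : ℕ → ℕ} (θ : WeightSpace L d) (k i : ℕ) :
    Matrix (Fin (d k)) (Fin (d i)) ℝ :=
  if h : i ≤ k then
    Nat.leRecOn (C := fun n => Matrix (Fin (d n)) (Fin (d i)) ℝ) h
      (fun {n} M => factorMat θ n * M) 1
  else 0

theorem subseqMat_self {L : ℕ} {d : ℕ → ℕ} (θ : WeightSpace L d) (i : ℕ) :
    subseqMat θ i i = 1 := by
  simp [subseqMat, Nat.leRecOn_self]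

theorem subseqMat_succ {L : ℕ} {d : ℕ → ℕ} (θ : WeightSpace L d) {k i : ℕ} (h : i ≤ k) :
    subseqMat θ (k + 1) i = factorMat θ k * subseqMat θ k i := by
  have h' : i ≤ k + 1 := Nat.le_succ_of_le h
  rw [subseqMat, subseqMat, dif_pos h', dif_pos h, Nat.leRecOn_succ h]

/-- The matrix multiplication map `μ(θ) = W_L ⋯ W_1`. -/
def mulMap (L : ℕ) (d : ℕ → ℕ) (θ : WeightSpace L d) : Matrix (Fin (d L)) (Fin (d 0)) ℝ :=
  subseqMat θ L 0

/-- The differential map `dμ(θ)`, the Fréchet derivative of `μ` at `θ`. -/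
noncomputable def diffMap {L : ℕ} {d : ℕ → ℕ} (θ : WeightSpace L d) :
    WeightSpace L d →L[ℝ] Matrix (Fin (d L)) (Fin (d 0)) ℝ :=
  fderiv ℝ (mulMap L d) θ

/-! ### Subspaces attached to matrices -/

/-- `null M`. -/
def nullSp {p q : ℕ} (M : Matrix (Fin p) (Fin q) ℝ) : Submodule ℝ (Fin q → ℝ) :=
  LinearMap.ker M.mulVecLin

/-- `col M`. -/
def colSp {p q : ℕ} (M : Matrix (Fin p) (Fin q) ℝ) : Submodule ℝ (Fin p → ℝ) :=
  LinearMap.range M.mulVecLin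

/-- `row M`. -/
def rowSp {p q : ℕ} (M : Matrix (Fin p) (Fin q) ℝ) : Submodule ℝ (Fin q → ℝ) :=
  colSp M.transpose

/-- `U ⊗ V = {M : col M ⊆ U and row M ⊆ V}`. -/
def tensorSp {p q : ℕ} (U : Submodule ℝ (Fin p → ℝ)) (V : Submodule ℝ (Fin q → ℝ)) :
    Submodule ℝ (Matrix (Fin p) (Fin q) ℝ) where
  carrier := {M | colSp M ≤ U ∧ rowSp M ≤ V}
  zero_mem' := by
    constructor <;> rintro _ ⟨v, rfl⟩ <;> simp
  add_mem' := by
    rintro M N ⟨hM, hM'⟩ ⟨hN, hN'⟩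
    constructor <;> rintro _ ⟨v, rfl⟩
    · simpa [Matrix.add_mulVec] using U.add_mem (hM ⟨v, rfl⟩) (hN ⟨v, rfl⟩)
    · simpa [Matrix.add_mulVec] using V.add_mem (hM' ⟨v, rfl⟩) (hN' ⟨v, rfl⟩)
  smul_mem' := by
    rintro c M ⟨hM, hM'⟩
    constructor <;> rintro _ ⟨v, rfl⟩
    · simpa [Matrix.smul_mulVec] using U.smul_mem c (hM ⟨v, rfl⟩)
    · simpa [Matrix.smul_mulVec] using V.smul_mem c (hM' ⟨v, rfl⟩)

/-- `Z ↓ Y = {X ⊆ Z : Z = X ⊕ Y}`. -/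
def complementsIn {n : ℕ} (Z Y : Submodule ℝ (Fin n → ℝ)) :
    Set (Submodule ℝ (Fin n → ℝ)) :=
  {X | X ≤ Z ∧ X ⊔ Y = Z ∧ X ⊓ Y = ⊥}

/-- A set `X` of subspaces is a prebasis for `V` if `V` is the direct sum of the members of `X`:
each member meets the sum of the others only in `0`, and together they span `V`. -/
def IsPrebasis {E : Type*} [AddCommGroup E] [Module ℝ E] (X : Set (Submodule ℝ E))
    (V : Submodule ℝ E) : Prop :=
  sSupIndep X ∧ sSup X = V

/-! ### Flow subspaces and flow prebasis subspaces -/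

/-- The flow subspace `A_{kji} = null W_{k+1∼j} ∩ col W_{j∼i}` for `k ∈ [j-1, L]` and
`i ∈ [-1, j]`, with `W_{j∼-1} = 0`. -/
def flowA {L : ℕ} {d : ℕ → ℕ} (θ : WeightSpace L d) (k : ℤ) (j : ℕ) (i : ℤ) :
    Submodule ℝ (Fin (d j) → ℝ) :=
  nullSp (subseqMat θ (k + 1).toNat j) ⊓ (if i < 0 then ⊥ else colSp (subseqMat θ j i.toNat))

/-- The flow subspace `B_{kji} = row W_{k∼j} ∩ null W_{j∼i-1}ᵀ` for `k ∈ [j, L+1]` and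
`i ∈ [0, j+1]`, with `W_{j∼-1} = 0`. -/
def flowB {L : ℕ} {d : ℕ → ℕ} (θ : WeightSpace L d) (k j i : ℕ) :
    Submodule ℝ (Fin (d j) → ℝ) :=
  rowSp (subseqMat θ k j) ⊓ (if i = 0 then ⊤ else nullSp (subseqMat θ j (i - 1)).transpose)

/-- A family of subspaces of the unit layers: `a k j i` is a subspace of `ℝ^{d j}`. -/
abbrev LayerFamily (d : ℕ → ℕ) : Type :=
  (k j i : ℕ) → Submodule ℝ (Fin (d j) → ℝ)

/-- `a` and `b` are flow prebasis subspaces at `θ`: prebasis subspaces `a_{kji}`, `b_{kji}`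
(for `L ≥ k ≥ j ≥ i ≥ 0`) that flow through the network and the transpose network, that is,
`a_{kji} = W_j a_{k,j-1,i}` and `b_{k,j-1,i} = W_jᵀ b_{kji}` for `L ≥ k ≥ j > i ≥ 0`
(below, `j = n + 1`). -/
structure IsFlowPrebasis {L : ℕ} {d : ℕ → ℕ} (θ : WeightSpace L d) (a b : LayerFamily d) :
    Prop where
  mem_a : ∀ k j i : ℕ, i ≤ j → j ≤ k → k ≤ L →
    a k j i ∈ complementsIn (flowA θ k j i) (flowA θ k j ((i : ℤ) - 1) ⊔ flowA θ ((k : ℤ) - 1) j i)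
  mem_b : ∀ k j i : ℕ, i ≤ j → j ≤ k → k ≤ L →
    b k j i ∈ complementsIn (flowB θ k j i) (flowB θ k j (i + 1) ⊔ flowB θ (k + 1) j i)
  flow_a : ∀ k n i : ℕ, i ≤ n → n + 1 ≤ k → k ≤ L →
    a k (n + 1) i = (a k n i).map (factorMat θ n).mulVecLin
  flow_b : ∀ k n i : ℕ, i ≤ n → n + 1 ≤ k → k ≤ L →
    b k n i = (b k (n + 1) i).map (factorMat θ n).transpose.mulVecLin

/-! ### One-matrix and two-matrix subspaces -/

/-- The weight vector `(0, …, 0, M, 0, …, 0)` with `M` in the place of `W_{n+1}`, as a linear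
function of `M`. -/
def placeAt {L : ℕ} (d : ℕ → ℕ) (n : ℕ) (hn : n < L) :
    Matrix (Fin (d (n + 1))) (Fin (d n)) ℝ →ₗ[ℝ] WeightSpace L d :=
  LinearMap.single ℝ (fun m : Fin L => Matrix (Fin (d (m + 1))) (Fin (d m)) ℝ) ⟨n, hn⟩

/-- The one-matrix subspace `φ_{lkjih}` with `j = n + 1`: all `(0, …, 0, M, 0, …, 0)` with `M`
in the place of `W_j` and `M ∈ a_{lji} ⊗ b_{k,j-1,h}`. -/
def oneMatrixSp {L : ℕ} {d : ℕ → ℕ} (a b : LayerFamily d) (l k n i h : ℕ) (hn : n < L) :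
    Submodule ℝ (WeightSpace L d) :=
  (tensorSp (a l (n + 1) i) (b k n h)).map (placeAt d n hn)

/-- The map `H ↦ (0, …, 0, W_{j+1} H, -H W_j, 0, …, 0)` with `j = n + 1`, where `W_{j+1} H` is in
the place of `W_{j+1}` and `-H W_j` in the place of `W_j`. -/
def twoMatrixMap {L : ℕ} {d : ℕ → ℕ} (θ : WeightSpace L d) (n : ℕ) (hn : n + 1 < L) :
    Matrix (Fin (d (n + 1))) (Fin (d (n + 1))) ℝ →ₗ[ℝ] WeightSpace L d where
  toFun H := placeAt d (n + 1) hn (factorMat θ (n + 1) * H)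
    + placeAt d n (Nat.lt_of_succ_lt hn) (-(H * factorMat θ n))
  map_add' H K := by
    rw [Matrix.mul_add, Matrix.add_mul, neg_add, map_add, map_add]
    abel
  map_smul' c H := by
    rw [Matrix.mul_smul, Matrix.smul_mul, ← smul_neg, map_smul, map_smul, RingHom.id_apply,
      smul_add]

/-- The two-matrix subspace `τ_{lkjih}` with `j = n + 1`: all
`(0, …, 0, W_{j+1} H, -H W_j, 0, …, 0)` with `H ∈ a_{lji} ⊗ b_{kjh}`. -/
def twoMatrixSp {L : ℕ} {d : ℕ → ℕ} (θ : WeightSpace L d) (a b : LayerFamily d)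
    (l k n i h : ℕ) (hn : n + 1 < L) : Submodule ℝ (WeightSpace L d) :=
  (tensorSp (a l (n + 1) i) (b k (n + 1) h)).map (twoMatrixMap θ n hn)

/-- The set of all `φ_{lkjih} ≠ {0}` with `L ≥ l ≥ j ≥ i ≥ 0`, `L ≥ k ≥ j - 1 ≥ h ≥ 0` and
`P l k j i h` (below, `j = n + 1`). -/
def oneMatrixSet {L : ℕ} {d : ℕ → ℕ} (a b : LayerFamily d) (P : ℕ → ℕ → ℕ → ℕ → ℕ → Prop) :
    Set (Submodule ℝ (WeightSpace L d)) :=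
  {X | X ≠ ⊥ ∧ ∃ (l k n i h : ℕ) (hn : n < L),
    n + 1 ≤ l ∧ l ≤ L ∧ i ≤ n + 1 ∧ n ≤ k ∧ k ≤ L ∧ h ≤ n ∧ P l k (n + 1) i h ∧
      X = oneMatrixSp a b l k n i h hn}

/-- The set of all `τ_{lkjih} ≠ {0}` with `L ≥ l > j > h ≥ 0`, `L ≥ k ≥ j ≥ i ≥ 0` and
`P l k j i h` (below, `j = n + 1`). -/
def twoMatrixSet {L : ℕ} {d : ℕ → ℕ} (θ : WeightSpace L d) (a b : LayerFamily d)
    (P : ℕ → ℕ → ℕ → ℕ → ℕ → Prop) : Set (Submodule ℝ (WeightSpace L d)) :=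
  {X | X ≠ ⊥ ∧ ∃ (l k n i h : ℕ) (hn : n + 1 < L),
    n + 1 < l ∧ l ≤ L ∧ h < n + 1 ∧ n + 1 ≤ k ∧ k ≤ L ∧ i ≤ n + 1 ∧ P l k (n + 1) i h ∧
      X = twoMatrixSp θ a b l k n i h hn}

/-! ### The freedom, stratum and fiber prebases -/

/-- The one-matrix prebasis `Θ_O`. -/
def thetaO {L : ℕ} {d : ℕ → ℕ} (a b : LayerFamily d) : Set (Submodule ℝ (WeightSpace L d)) :=
  oneMatrixSet a b fun _ _ _ _ _ => True

/-- `Θ_O^{L0}`: the `φ_{lkjih} ∈ Θ_O` with `l = L` and `h = 0`. -/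
def thetaOL0 {L : ℕ} {d : ℕ → ℕ} (a b : LayerFamily d) : Set (Submodule ℝ (WeightSpace L d)) :=
  oneMatrixSet a b fun l _ _ _ h => l = L ∧ h = 0

/-- `Θ_O^{comb}`: the `φ_{lkjih} ∈ Θ_O` with `l > k` and `i > h`. -/
def thetaOComb {L : ℕ} {d : ℕ → ℕ} (a b : LayerFamily d) : Set (Submodule ℝ (WeightSpace L d)) :=
  oneMatrixSet a b fun l k _ i h => k < l ∧ h < i

/-- `Θ_T^{L0}`: the `τ_{lkjih} ∈ Θ_T` with `l = L` and `h = 0`. -/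
def thetaTL0 {L : ℕ} {d : ℕ → ℕ} (θ : WeightSpace L d) (a b : LayerFamily d) :
    Set (Submodule ℝ (WeightSpace L d)) :=
  twoMatrixSet θ a b fun l _ _ _ h => l = L ∧ h = 0

/-- `Θ_T^{comb}`: the `τ_{lkjih} ∈ Θ_T` with `l > k` and `i > h`. -/
def thetaTComb {L : ℕ} {d : ℕ → ℕ} (θ : WeightSpace L d) (a b : LayerFamily d) :
    Set (Submodule ℝ (WeightSpace L d)) :=
  twoMatrixSet θ a b fun l k _ i h => k < l ∧ h < i

/-- The freedom prebasis `Θ^{free} = (Θ_O \ Θ_O^{L0}) ∪ Θ_T^{L0}`. -/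
def thetaFree {L : ℕ} {d : ℕ → ℕ} (θ : WeightSpace L d) (a b : LayerFamily d) :
    Set (Submodule ℝ (WeightSpace L d)) :=
  (thetaO a b \ thetaOL0 a b) ∪ thetaTL0 θ a b

/-- The stratum prebasis
`Θ^{stratum} = (Θ_O \ Θ_O^{L0} \ Θ_O^{comb}) ∪ Θ_T^{L0} ∪ Θ_T^{comb}`. -/
def thetaStratum {L : ℕ} {d : ℕ → ℕ} (θ : WeightSpace L d) (a b : LayerFamily d) :
    Set (Submodule ℝ (WeightSpace L d)) :=
  ((thetaO a b \ thetaOL0 a b) \ thetaOComb a b) ∪ thetaTL0 θ a b ∪ thetaTComb θ a b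

/-- The fiber prebasis: `Θ^{stratum}` together with all `φ_{l,k,k+1,i,h} ∈ Θ_O` with
(`L > l` or `h > 0`) and `l > k` and `i > h`. -/
def thetaFiber {L : ℕ} {d : ℕ → ℕ} (θ : WeightSpace L d) (a b : LayerFamily d) :
    Set (Submodule ℝ (WeightSpace L d)) :=
  thetaStratum θ a b ∪
    oneMatrixSet a b fun l k j i h => j = k + 1 ∧ (l < L ∨ 0 < h) ∧ k < l ∧ h < i

/-! ### The formula for the differential map -/

section Derivative

attribute [local instance] Matrix.normedAddCommGroup Matrix.normedSpace

theorem factorMat_entry_hasFDerivAt {L : ℕ} {d : ℕ → ℕ} (θ : WeightSpace L d) (n : ℕ)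
    (x : Fin (d (n + 1))) (y : Fin (d n)) :
    ∃ D : WeightSpace L d →L[ℝ] ℝ,
      HasFDerivAt (fun η : WeightSpace L d => factorMat η n x y) D θ ∧
      ∀ Δ : WeightSpace L d, D Δ = factorMat Δ n x y := by
  let l : WeightSpace L d →ₗ[ℝ] ℝ :=
    { toFun := fun η => factorMat η n x y
      map_add' := by intro η ξ; simp only [factorMat]; split_ifs <;> simp
      map_smul' := by intro c η; simp only [factorMat]; split_ifs <;> simp }
  exact ⟨l.toContinuousLinearMap, l.toContinuousLinearMap.hasFDerivAt, fun Δ => rfl⟩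

theorem subseqMat_entry_hasFDerivAt {L : ℕ} {d : ℕ → ℕ} (θ : WeightSpace L d) (i k : ℕ)
    (hik : i ≤ k) : ∀ (x : Fin (d k)) (y : Fin (d i)),
    ∃ D : WeightSpace L d →L[ℝ] ℝ,
      HasFDerivAt (fun η : WeightSpace L d => subseqMat η k i x y) D θ ∧
      ∀ Δ : WeightSpace L d, D Δ = (∑ m ∈ Finset.Ico i k,
        subseqMat θ k (m + 1) * factorMat Δ m * subseqMat θ m i) x y := by
  induction k, hik using Nat.le_induction with
  | base =>
    intro x y
    refine ⟨0, ?_, ?_⟩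
    · simp only [subseqMat_self]
      exact hasFDerivAt_const _ _
    · simp
  | succ k hik ih =>
    intro x y
    choose D hD hD' using fun c => ih c y
    choose F hF hF' using fun c => factorMat_entry_hasFDerivAt θ k x c
    refine ⟨∑ c, (factorMat θ k x c • D c + subseqMat θ k i c y • F c), ?_, ?_⟩
    · simp only [subseqMat_succ _ hik, Matrix.mul_apply]
      exact HasFDerivAt.fun_sum fun c _ => (hF c).mul (hD c)
    · intro Δ
      have h1 : ∑ m ∈ Finset.Ico i k,
          subseqMat θ (k + 1) (m + 1) * factorMat Δ m * subseqMat θ m i =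
          factorMat θ k * ∑ m ∈ Finset.Ico i k,
          subseqMat θ k (m + 1) * factorMat Δ m * subseqMat θ m i := by
        rw [Matrix.mul_sum]
        refine Finset.sum_congr rfl fun m hm => ?_
        rw [subseqMat_succ θ (Finset.mem_Ico.mp hm).2]
        simp only [Matrix.mul_assoc]
      rw [Finset.sum_Ico_succ_top hik, h1, subseqMat_self, Matrix.one_mul, Matrix.add_apply,
        Matrix.mul_apply, Matrix.mul_apply, ← Finset.sum_add_distrib]
      simp only [_root_.sum_apply, _root_.add_apply,
        _root_.smul_apply, smul_eq_mul, hD', hF']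
      exact Finset.sum_congr rfl fun c _ => by ring

theorem mulMap_hasFDerivAt {L : ℕ} {d : ℕ → ℕ} (θ : WeightSpace L d) :
    ∃ D : WeightSpace L d →L[ℝ] Matrix (Fin (d L)) (Fin (d 0)) ℝ,
      HasFDerivAt (mulMap L d) D θ ∧
      ∀ Δ : WeightSpace L d, D Δ = ∑ m ∈ Finset.Ico 0 L,
        subseqMat θ L (m + 1) * factorMat Δ m * subseqMat θ m 0 := by
  choose D hD hD' using subseqMat_entry_hasFDerivAt θ 0 L (Nat.zero_le L)
  refine ⟨ContinuousLinearMap.pi fun x => ContinuousLinearMap.pi fun y => D x y, ?_, ?_⟩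
  · exact hasFDerivAt_pi.2 fun x => hasFDerivAt_pi.2 fun y => hD x y
  · intro Δ
    ext x y
    exact hD' x y Δ

end Derivative

/-- `dμ(θ)(ΔW_L, …, ΔW_1) = ∑_{j=1}^L W_{L∼j} ΔW_j W_{j-1∼0}` (below, `j = m + 1`). -/
theorem diffMap_apply {L : ℕ} {d : ℕ → ℕ} (θ Δ : WeightSpace L d) :
    diffMap θ Δ = ∑ m : Fin L, subseqMat θ L (m + 1) * Δ m * subseqMat θ m 0 := by
  obtain ⟨D, hD, hD'⟩ := mulMap_hasFDerivAt θ
  have h : diffMap θ = D := hD.fderiv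
  rw [h]
  refine (hD' Δ).trans ?_
  rw [Nat.Ico_zero_eq_range, Finset.sum_range]
  refine Finset.sum_congr rfl fun m _ => ?_
  simp [factorMat]

/-! ### Independent families of subspaces -/

section Independence

variable {E : Type*} [AddCommGroup E] [Module ℝ E]

/-! In layer `j` the `a_{kji}` are complements along two flags, `null W_{k+1∼j}` and `col W_{j∼i}`,
so they decompose `ℝ^{d_j}`; likewise the `b_{kji}`. Tensoring `a_{lji}` with `b_{k,j-1,h}` and
placing the result in the slot of `W_j` decomposes the weight space into the `φ_{lkjih}`
(`iSupIndep_oneMatrixFam_and_iSup`).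

Wherever `τ_{lkjih}` is defined it may replace `φ_{lkjih}`: its component `-H W_j` fills the same
one-matrix subspace bijectively, and `W_{j+1} H` lies in a one-matrix subspace of the next slot. The
exchange is triangular in the slot, so any choice `Q` of exchanged indices leaves a direct sum
decomposition (`iSupIndep_tradedFam`, `iSup_tradedFam`).

Suppose `Q` contains all indices with `l = L`, `h = 0`. Then every member lies in the kernel, except
the `φ_{Lkji0}` for which no `τ` exists. On the sum of those exceptions `dμ(θ)` is injective, since
they land in the distinct summands `a_{LLi} ⊗ b_{k00}`. The modular law then identifies the sum of
the other members with the kernel (`iSup_tradedFam_eq_ker`). The freedom and fiber prebases are two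
choices of `Q`.

The dimension comes separately from rank–nullity: the range of `dμ(θ)` is `∑ col W_{L∼j} ⊗ row
W_{j-1∼0}`, with one factor increasing and the other decreasing, so consecutive overlaps are
explicit. -/

theorem iSupIndep_of_projections {ι : Type*} {S : ι → Submodule ℝ E} (π : ι → E →ₗ[ℝ] E)
    (h1 : ∀ i, ∀ x ∈ S i, π i x = x) (h0 : ∀ i j, i ≠ j → ∀ x ∈ S j, π i x = 0) :
    iSupIndep S := by
  rw [iSupIndep_iff_finsetSum_eq_zero_imp_eq_zero]
  intro s v hv hs i hi
  have h := congrArg (π i) hs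
  rw [map_sum, map_zero, Finset.sum_eq_single_of_mem i hi
    fun j hj hji => h0 i j hji.symm _ (hv j hj), h1 i _ (hv i hi)] at h
  exact h

theorem exists_projections {ι : Type*} [Fintype ι] {S : ι → Submodule ℝ E} (hS : iSupIndep S)
    (hT : ⨆ i, S i = ⊤) :
    ∃ π : ι → E →ₗ[ℝ] E, (∀ i, ∀ x ∈ S i, π i x = x) ∧
      (∀ i j, i ≠ j → ∀ x ∈ S j, π i x = 0) ∧ (∀ i x, π i x ∈ S i) ∧ ∀ x, ∑ i, π i x = x := by
  have hc : ∀ i, IsCompl (S i) (⨆ (j) (_ : j ≠ i), S j) := fun i =>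
    ⟨hS i, by rw [codisjoint_iff, ← iSup_split_single S i, hT]⟩
  have h1 : ∀ i, ∀ x ∈ S i, (S i).projection _ (hc i) x = x := fun i x hx =>
    Submodule.projection_apply_left (hc i) ⟨x, hx⟩
  have h0 : ∀ i j, i ≠ j → ∀ x ∈ S j, (S i).projection _ (hc i) x = 0 := fun i j hij x hx => by
    refine (Submodule.projection_apply_eq_zero_iff (hc i)).2 ?_
    exact le_iSup₂ (f := fun j (_ : j ≠ i) => S j) j hij.symm hx
  refine ⟨fun i => (S i).projection _ (hc i), h1, h0,
    fun i x => Submodule.projection_apply_mem (hc i) x, fun x => ?_⟩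
  have hx : x ∈ ⨆ i, S i := hT ▸ Submodule.mem_top
  induction hx using Submodule.iSup_induction' with
  | mem j y hy =>
    rw [Finset.sum_eq_single_of_mem j (Finset.mem_univ j) fun i _ hij => h0 i j hij y hy, h1 j y hy]
  | zero => simp
  | add y z _ _ ihy ihz => simp only [map_add, Finset.sum_add_distrib, ihy, ihz]

/-- Complements taken along two flags `F` and `G` are independent. Here `F' p` and `G' q` are the
predecessors of `F p` and `G q`. -/
theorem iSupIndep_of_flags {K Q : Type*} [LinearOrder K] [LinearOrder Q]
    {c : K × Q → Submodule ℝ E} {F F' : K → Submodule ℝ E} {G G' : Q → Submodule ℝ E}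
    (hF : ∀ p p', p < p' → F p ≤ F' p') (hG : ∀ q, G' q ≤ G q)
    (hG' : ∀ q q', q < q' → G q ≤ G' q')
    (hle : ∀ p q, c (p, q) ≤ F p ⊓ G q)
    (hbot : ∀ p q, c (p, q) ⊓ (F p ⊓ G' q ⊔ F' p ⊓ G q) = ⊥) : iSupIndep c := by
  classical
  rw [iSupIndep_iff_finsetSum_eq_zero_imp_eq_zero]
  intro s v hv hs
  by_contra! hne
  obtain ⟨i, hi, hvi⟩ := hne
  -- Take the lexicographically last nonzero term; the earlier ones lie in `F' p` or in `F p ⊓ G'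
  -- q`.
  obtain ⟨⟨p, q⟩, hx, hmax⟩ := Finset.exists_max_image (s.filter (v · ≠ 0)) (toLex ·)
    ⟨i, Finset.mem_filter.2 ⟨hi, hvi⟩⟩
  obtain ⟨hxs, hx0⟩ := Finset.mem_filter.1 hx
  apply hx0
  have hmem := hle p q (hv _ hxs)
  have hsum : ∑ y ∈ s.erase (p, q), v y ∈ F' p ⊔ F p ⊓ G' q := by
    refine Submodule.sum_mem _ fun y hy => ?_
    obtain ⟨hyx, hys⟩ := Finset.mem_erase.1 hy
    by_cases hy0 : v y = 0
    · rw [hy0]; exact Submodule.zero_mem _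
    have hlt := lt_of_le_of_ne (hmax y (Finset.mem_filter.2 ⟨hys, hy0⟩)) (by simpa using hyx)
    have hym := hle y.1 y.2 (hv y hys)
    rcases (Prod.Lex.toLex_lt_toLex.1 hlt) with h | ⟨h, h'⟩
    · exact Submodule.mem_sup_left (hF _ _ h hym.1)
    · exact Submodule.mem_sup_right ⟨(show y.1 = p from h) ▸ hym.1, hG' _ _ h' hym.2⟩
  have hv' : v (p, q) ∈ (F' p ⊔ F p ⊓ G' q) ⊓ G q := by
    refine ⟨?_, hmem.2⟩
    rw [← Finset.add_sum_erase s v hxs, add_eq_zero_iff_eq_neg] at hs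
    rw [hs]
    exact Submodule.neg_mem _ hsum
  -- Modular law, using `F p ⊓ G' q ≤ G q`.
  rw [sup_comm, sup_inf_assoc_of_le _ (inf_le_right.trans (hG q))] at hv'
  have hb : v (p, q) ∈ c (p, q) ⊓ (F p ⊓ G' q ⊔ F' p ⊓ G q) := ⟨hv _ hxs, hv'⟩
  rwa [hbot, Submodule.mem_bot] at hb

/-- Complements taken along two flags `F` and `G` span. -/
theorem inf_le_iSup_of_flags {K Q : Type*} [LinearOrder K] [LinearOrder Q] [WellFoundedLT K]
    [WellFoundedLT Q] {c : K × Q → Submodule ℝ E} {F F' : K → Submodule ℝ E}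
    {G G' : Q → Submodule ℝ E} (hF : ∀ p, F' p = ⊥ ∨ ∃ p' < p, F' p = F p')
    (hG : ∀ q, G' q = ⊥ ∨ ∃ q' < q, G' q = G q')
    (htop : ∀ p q, c (p, q) ⊔ (F p ⊓ G' q ⊔ F' p ⊓ G q) = F p ⊓ G q) (p : K) (q : Q) :
    F p ⊓ G q ≤ ⨆ x, c x := by
  induction p using WellFoundedLT.induction generalizing q with
  | ind p ihp =>
    induction q using WellFoundedLT.induction with
    | ind q ihq =>
      rw [← htop]
      refine sup_le (le_iSup c _) (sup_le ?_ ?_)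
      · rcases hG q with h | ⟨q', hq', h⟩
        · simp [h]
        · rw [h]; exact ihq q' hq'
      · rcases hF p with h | ⟨p', hp', h⟩
        · simp [h]
        · rw [h]; exact ihp p' hp' q

/-- A family `Ψ` that is unitriangular with respect to an independent family `Φ` is independent. -/
theorem iSupIndep_of_triangular {ι : Type*} {Φ Ψ : ι → Submodule ℝ E} (r : ι → ℕ)
    (hΦ : iSupIndep Φ) (hle : ∀ x, Ψ x ≤ Φ x ⊔ ⨆ (y) (_ : r x < r y), Φ y)
    (hbot : ∀ x, Ψ x ⊓ ⨆ (y) (_ : r x < r y), Φ y = ⊥) : iSupIndep Ψ := by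
  classical
  rw [iSupIndep_iff_finsetSum_eq_zero_imp_eq_zero]
  intro s v hv hs
  by_contra! hne
  obtain ⟨i, hi, hvi⟩ := hne
  -- For a nonzero term of least rank, all other terms lie in the span of the `Φ y` with `y ≠ x`.
  obtain ⟨x, hx, hmin⟩ := Finset.exists_min_image (s.filter (v · ≠ 0)) r
    ⟨i, Finset.mem_filter.2 ⟨hi, hvi⟩⟩
  obtain ⟨hxs, hx0⟩ := Finset.mem_filter.1 hx
  apply hx0
  have hgt : ∀ z, r x ≤ r z →
      (⨆ (y) (_ : r z < r y), Φ y) ≤ ⨆ (y) (_ : y ≠ x), Φ y := fun z hz =>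
    iSup₂_le fun y hy => le_iSup₂ (f := fun y (_ : y ≠ x) => Φ y) y
      (by rintro rfl; omega)
  have hsum : ∑ y ∈ s.erase x, v y ∈ ⨆ (y) (_ : y ≠ x), Φ y := by
    refine Submodule.sum_mem _ fun y hy => ?_
    obtain ⟨hyx, hys⟩ := Finset.mem_erase.1 hy
    by_cases hy0 : v y = 0
    · rw [hy0]; exact Submodule.zero_mem _
    have hle' := hmin y (Finset.mem_filter.2 ⟨hys, hy0⟩)
    exact (hle y).trans (sup_le (le_iSup₂ (f := fun y (_ : y ≠ x) => Φ y) y hyx) (hgt y hle'))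
      (hv y hys)
  rw [← Finset.add_sum_erase s v hxs, add_eq_zero_iff_eq_neg] at hs
  have hvx : v x ∈ ⨆ (y) (_ : y ≠ x), Φ y := hs ▸ Submodule.neg_mem _ hsum
  obtain ⟨f, hf, g, hg, hfg⟩ := Submodule.mem_sup.1 (hle x (hv x hxs))
  -- The `Φ x` component of `v x` also lies in the span of the other `Φ y`, so it vanishes and only
  -- the higher-rank part remains.
  have hf0 : f = 0 := by
    refine Submodule.disjoint_def.1 (hΦ x) f hf ?_
    rw [show f = v x - g from eq_sub_of_add_eq hfg]
    exact Submodule.sub_mem _ hvx (hgt x le_rfl hg)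
  have hb : v x ∈ Ψ x ⊓ ⨆ (y) (_ : r x < r y), Φ y := ⟨hv x hxs, by rwa [← hfg, hf0, zero_add]⟩
  rwa [hbot, Submodule.mem_bot] at hb

/-- A family `Ψ` that is unitriangular with respect to a spanning family `Φ` is spanning. -/
theorem iSup_le_iSup_of_triangular {ι : Type*} {Φ Ψ : ι → Submodule ℝ E} (r : ι → ℕ) {N : ℕ}
    (hr : ∀ x, r x ≤ N) (hle : ∀ x, Φ x ≤ Ψ x ⊔ ⨆ (y) (_ : r x < r y), Φ y) :
    ⨆ x, Φ x ≤ ⨆ x, Ψ x := by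
  -- Descending induction on the rank: members of larger rank are already covered.
  have key : ∀ n x, N - r x ≤ n → Φ x ≤ ⨆ x, Ψ x := by
    intro n
    induction n with
    | zero =>
      intro x hx
      refine (hle x).trans (sup_le (le_iSup Ψ x) (iSup₂_le fun y hy => ?_))
      have := hr y
      omega
    | succ n ih =>
      intro x hx
      refine (hle x).trans (sup_le (le_iSup Ψ x) (iSup₂_le fun y hy => ih y ?_))
      have := hr y
      omega
  exact iSup_le fun x => key _ x le_rfl

/-- A linear map that is injective on each member of a family, with independent images, is
injective on the sum of the family. -/
theorem iSup_inf_ker_eq_bot {ι E' : Type*} [AddCommGroup E'] [Module ℝ E'] (f : E →ₗ[ℝ] E')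
    {Ψ : ι → Submodule ℝ E} (hinj : ∀ x, Ψ x ⊓ LinearMap.ker f = ⊥) {S : ι → Submodule ℝ E'}
    (hmap : ∀ x, ∀ v ∈ Ψ x, f v ∈ S x) (hS : iSupIndep S) :
    (⨆ x, Ψ x) ⊓ LinearMap.ker f = ⊥ := by
  rw [eq_bot_iff]
  rintro v ⟨hv, hv0⟩
  obtain ⟨g, hg, rfl⟩ := (Submodule.mem_iSup_iff_exists_finsupp ..).1 hv
  have hv0' : ∑ x ∈ g.support, f (g x) = 0 := by
    rw [← map_sum]; exact hv0
  have h := (iSupIndep_iff_finsetSum_eq_zero_imp_eq_zero S).1 hS g.support (fun x => f (g x))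
    (fun x _ => hmap x _ (hg x)) hv0'
  refine Submodule.sum_mem _ fun x hx => ?_
  rw [← hinj x]
  exact ⟨hg x, h x hx⟩

theorem iSupIndep_sigma_single {ι : Type*} [DecidableEq ι] {M : ι → Type*}
    [∀ i, AddCommGroup (M i)] [∀ i, Module ℝ (M i)] {κ : ι → Type*} [∀ i, Fintype (κ i)]
    {S : (i : ι) → κ i → Submodule ℝ (M i)}
    (hS : ∀ i, iSupIndep (S i)) (hT : ∀ i, ⨆ x, S i x = ⊤) :
    iSupIndep fun x : Σ i, κ i => (S x.1 x.2).map (LinearMap.single ℝ M x.1) := by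
  choose π h1 h0 _ _ using fun i => exists_projections (hS i) (hT i)
  refine iSupIndep_of_projections
    (fun x => LinearMap.single ℝ M x.1 ∘ₗ π x.1 x.2 ∘ₗ LinearMap.proj x.1) ?_ ?_
  · rintro ⟨i, x⟩ _ ⟨m, hm, rfl⟩
    simp [h1 i x m hm]
  · rintro ⟨i, x⟩ ⟨j, y⟩ hne _ ⟨m, hm, rfl⟩
    by_cases hij : i = j
    · subst hij
      have hxy : x ≠ y := fun h => hne (by rw [h])
      simp [h0 i x y hxy m hm]
    · simp [Pi.single_eq_of_ne hij]

theorem iSup_sigma_single {ι : Type*} [Fintype ι] [DecidableEq ι] {M : ι → Type*}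
    [∀ i, AddCommGroup (M i)] [∀ i, Module ℝ (M i)] {κ : ι → Type*}
    {S : (i : ι) → κ i → Submodule ℝ (M i)} (hT : ∀ i, ⨆ x, S i x = ⊤) :
    ⨆ x : Σ i, κ i, (S x.1 x.2).map (LinearMap.single ℝ M x.1) = ⊤ := by
  rw [iSup_sigma, eq_top_iff]
  rintro v -
  rw [← Finset.univ_sum_single v]
  exact Submodule.sum_mem _ fun i _ => Submodule.mem_iSup_of_mem i (by
    have h : v i ∈ ⨆ x, S i x := hT i ▸ Submodule.mem_top
    have h' := Submodule.mem_map_of_mem (f := LinearMap.single ℝ M i) h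
    rwa [Submodule.map_iSup] at h')

end Independence

/-! ### Spaces of matrices with prescribed column and row spaces -/

theorem mem_tensorSp {p q : ℕ} {U : Submodule ℝ (Fin p → ℝ)} {V : Submodule ℝ (Fin q → ℝ)}
    {M : Matrix (Fin p) (Fin q) ℝ} :
    M ∈ tensorSp U V ↔ (∀ v, M.mulVec v ∈ U) ∧ ∀ v, M.transpose.mulVec v ∈ V := by
  constructor
  · rintro ⟨h1, h2⟩
    exact ⟨fun v => h1 ⟨v, rfl⟩, fun v => h2 ⟨v, rfl⟩⟩
  · rintro ⟨h1, h2⟩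
    constructor <;> rintro _ ⟨v, rfl⟩
    · exact h1 v
    · exact h2 v

theorem tensorSp_mono {p q : ℕ} {U U' : Submodule ℝ (Fin p → ℝ)} {V V' : Submodule ℝ (Fin q → ℝ)}
    (hU : U ≤ U') (hV : V ≤ V') : tensorSp U V ≤ tensorSp U' V' :=
  fun _ h => ⟨h.1.trans hU, h.2.trans hV⟩

theorem mul_mem_tensorSp {p q p' q' : ℕ} {U : Submodule ℝ (Fin p → ℝ)}
    {V : Submodule ℝ (Fin q → ℝ)} (A : Matrix (Fin p') (Fin p) ℝ) (B : Matrix (Fin q) (Fin q') ℝ)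
    {M : Matrix (Fin p) (Fin q) ℝ} (hM : M ∈ tensorSp U V) :
    A * M * B ∈ tensorSp (U.map A.mulVecLin) (V.map B.transpose.mulVecLin) := by
  rw [mem_tensorSp] at hM ⊢
  constructor <;> intro v
  · refine ⟨M.mulVec (B.mulVec v), hM.1 _, ?_⟩
    simp [Matrix.mulVec_mulVec, Matrix.mul_assoc]
  · refine ⟨M.transpose.mulVec (A.transpose.mulVec v), hM.2 _, ?_⟩
    simp only [Matrix.mulVecLin_apply, Matrix.mulVec_mulVec, Matrix.transpose_mul]

/-- A partial right inverse of `A`, defined on the image of `U` and with values in `U`. -/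
theorem exists_section_on_map {p q : ℕ} (A : Matrix (Fin p) (Fin q) ℝ)
    (U : Submodule ℝ (Fin q → ℝ)) :
    ∃ G : Matrix (Fin q) (Fin p) ℝ, (∀ v, G.mulVec v ∈ U) ∧
      ∀ v ∈ U.map A.mulVecLin, A.mulVec (G.mulVec v) = v := by
  let f : U →ₗ[ℝ] U.map A.mulVecLin := A.mulVecLin.submoduleMap U
  obtain ⟨g, hg⟩ := f.exists_rightInverse_of_surjective
    (LinearMap.range_eq_top.2 (A.mulVecLin.submoduleMap_surjective U))
  obtain ⟨g', hg'⟩ := LinearMap.exists_extend g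
  refine ⟨LinearMap.toMatrix' (U.subtype ∘ₗ g'), fun v => ?_, fun v hv => ?_⟩
  · rw [LinearMap.toMatrix'_mulVec]
    exact (g' v).2
  · rw [LinearMap.toMatrix'_mulVec]
    have h1 : g' v = g ⟨v, hv⟩ := LinearMap.congr_fun hg' ⟨v, hv⟩
    have h2 : f (g ⟨v, hv⟩) = ⟨v, hv⟩ := LinearMap.congr_fun hg ⟨v, hv⟩
    have h3 := congrArg Subtype.val h2
    rw [LinearMap.comp_apply, h1]
    exact h3

/-- `A` is left cancellable on matrices whose columns lie in a subspace where `A` is injective. -/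
theorem eq_zero_of_mul_eq_zero {p q r : ℕ} {A : Matrix (Fin p) (Fin q) ℝ}
    {U : Submodule ℝ (Fin q → ℝ)} (hA : U ⊓ nullSp A = ⊥) {M : Matrix (Fin q) (Fin r) ℝ}
    (hM : ∀ v, M.mulVec v ∈ U) (h : A * M = 0) : M = 0 := by
  have : ∀ v, M.mulVec v = 0 := fun v => by
    have hv : M.mulVec v ∈ U ⊓ nullSp A := ⟨hM v, by simp [nullSp, Matrix.mulVec_mulVec, h]⟩
    rwa [hA, Submodule.mem_bot] at hv
  exact Matrix.mulVec_injective (funext fun v => by rw [this v, Matrix.zero_mulVec])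

/-- The lift is `M Gᵀ`, where `G` is a section of `Bᵀ` over `Bᵀ V` with values in `V`. -/
theorem exists_mul_eq_of_mem_tensorSp {p q q' : ℕ} {U : Submodule ℝ (Fin p → ℝ)}
    {V : Submodule ℝ (Fin q → ℝ)} (B : Matrix (Fin q) (Fin q') ℝ)
    {M : Matrix (Fin p) (Fin q') ℝ} (hM : M ∈ tensorSp U (V.map B.transpose.mulVecLin)) :
    ∃ H ∈ tensorSp U V, H * B = M := by
  obtain ⟨G, hG, hBG⟩ := exists_section_on_map B.transpose V
  rw [mem_tensorSp] at hM
  refine ⟨M * G.transpose, mem_tensorSp.2 ⟨fun v => ?_, fun v => ?_⟩, ?_⟩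
  · rw [← Matrix.mulVec_mulVec]; exact hM.1 _
  · rw [Matrix.transpose_mul, Matrix.transpose_transpose, ← Matrix.mulVec_mulVec]; exact hG _
  · apply Matrix.transpose_injective
    apply Matrix.mulVec_injective
    funext v
    rw [Matrix.transpose_mul, Matrix.transpose_mul, Matrix.transpose_transpose,
      ← Matrix.mulVec_mulVec, ← Matrix.mulVec_mulVec, hBG _ (hM.2 v)]

theorem transpose_mem_tensorSp {p q : ℕ} {U : Submodule ℝ (Fin p → ℝ)}
    {V : Submodule ℝ (Fin q → ℝ)} {M : Matrix (Fin p) (Fin q) ℝ} :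
    M.transpose ∈ tensorSp V U ↔ M ∈ tensorSp U V := by
  rw [mem_tensorSp, mem_tensorSp, Matrix.transpose_transpose, and_comm]

/-- `M ↦ A M B` carries the space of all matrices onto `col A ⊗ row B`. -/
theorem exists_mul_mul_eq {p q p' q' : ℕ} (A : Matrix (Fin p') (Fin p) ℝ)
    (B : Matrix (Fin q) (Fin q') ℝ) (N : Matrix (Fin p') (Fin q') ℝ) :
    N ∈ tensorSp (colSp A) (rowSp B) ↔
      ∃ M : Matrix (Fin p) (Fin q) ℝ, A * M * B = N := by
  constructor
  · intro hN
    rw [rowSp, colSp, colSp, LinearMap.range_eq_map, LinearMap.range_eq_map] at hN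
    obtain ⟨H, hH, rfl⟩ := exists_mul_eq_of_mem_tensorSp B hN
    -- `B` has been split off on the right; transposing lets the same lemma split off `A` on the
    -- left.
    rw [← transpose_mem_tensorSp] at hH
    rw [← Matrix.transpose_transpose A] at hH
    obtain ⟨K, -, hK⟩ := exists_mul_eq_of_mem_tensorSp A.transpose hH
    refine ⟨K.transpose, ?_⟩
    congr 1
    apply Matrix.transpose_injective
    rw [Matrix.transpose_mul, Matrix.transpose_transpose, hK]
  · rintro ⟨M, rfl⟩
    have h : M ∈ tensorSp (⊤ : Submodule ℝ _) (⊤ : Submodule ℝ _) := ⟨le_top, le_top⟩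
    simpa only [rowSp, colSp, LinearMap.range_eq_map] using mul_mem_tensorSp A B h

theorem tensorSp_inf {p q : ℕ} (U U' : Submodule ℝ (Fin p → ℝ)) (V V' : Submodule ℝ (Fin q → ℝ)) :
    tensorSp U V ⊓ tensorSp U' V' = tensorSp (U ⊓ U') (V ⊓ V') := by
  ext M
  simp only [Submodule.mem_inf, mem_tensorSp]
  constructor
  · rintro ⟨⟨h1, h2⟩, h3, h4⟩
    exact ⟨fun v => ⟨h1 v, h3 v⟩, fun v => ⟨h2 v, h4 v⟩⟩
  · rintro ⟨h1, h2⟩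
    exact ⟨⟨fun v => (h1 v).1, fun v => (h2 v).1⟩, fun v => (h1 v).2, fun v => (h2 v).2⟩

/-- If `P i` and `Q k` are the projections of the two decompositions, then `M ↦ P_i M Q_kᵀ` are the
projections of the matrix space, and `∑ P_i = 1`, `∑ Q_k = 1` make them add up to the identity. -/
theorem iSupIndep_tensorSp {p q : ℕ} {ι κ : Type*} [Fintype ι] [Fintype κ]
    {U : ι → Submodule ℝ (Fin p → ℝ)} {V : κ → Submodule ℝ (Fin q → ℝ)}
    (hU : iSupIndep U) (hU' : ⨆ i, U i = ⊤) (hV : iSupIndep V) (hV' : ⨆ i, V i = ⊤) :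
    iSupIndep (fun x : ι × κ => tensorSp (U x.1) (V x.2)) ∧
      ⨆ x : ι × κ, tensorSp (U x.1) (V x.2) = ⊤ := by
  obtain ⟨P, hP1, hP0, hPm, hPs⟩ := exists_projections hU hU'
  obtain ⟨Q, hQ1, hQ0, hQm, hQs⟩ := exists_projections hV hV'
  let T : ι × κ → Matrix (Fin p) (Fin q) ℝ →ₗ[ℝ] Matrix (Fin p) (Fin q) ℝ := fun x =>
    { toFun := fun M => LinearMap.toMatrix' (P x.1) * M * (LinearMap.toMatrix' (Q x.2)).transpose
      map_add' := fun M N => by rw [Matrix.mul_add, Matrix.add_mul]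
      map_smul' := fun c M => by rw [Matrix.mul_smul, Matrix.smul_mul, RingHom.id_apply] }
  have hT : ∀ x M, T x M =
    LinearMap.toMatrix' (P x.1) * M * (LinearMap.toMatrix' (Q x.2)).transpose := fun _ _ => rfl
  have hleft : ∀ (i : ι) (M N : Matrix (Fin p) (Fin q) ℝ),
      (∀ v, P i (M.mulVec v) = N.mulVec v) → LinearMap.toMatrix' (P i) * M = N := fun i M N h =>
    Matrix.mulVec_injective (funext fun v => by
      rw [← Matrix.mulVec_mulVec, LinearMap.toMatrix'_mulVec, h])
  have hright : ∀ (i : κ) (M N : Matrix (Fin p) (Fin q) ℝ),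
      (∀ v, Q i (M.transpose.mulVec v) = N.transpose.mulVec v) →
      M * (LinearMap.toMatrix' (Q i)).transpose = N := fun i M N h =>
    Matrix.transpose_injective (Matrix.mulVec_injective (funext fun v => by
      rw [Matrix.transpose_mul, Matrix.transpose_transpose, ← Matrix.mulVec_mulVec,
        LinearMap.toMatrix'_mulVec, h]))
  constructor
  · refine iSupIndep_of_projections T ?_ ?_
    · rintro ⟨i, k⟩ M hM
      rw [mem_tensorSp] at hM
      rw [hT, hleft i M M fun v => hP1 i _ (hM.1 v), hright k M M fun v => hQ1 k _ (hM.2 v)]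
    · rintro ⟨i, k⟩ ⟨i', k'⟩ hne M hM
      rw [mem_tensorSp] at hM
      by_cases hi : i = i'
      · have hk : k ≠ k' := fun hk => hne (by rw [hi, hk])
        rw [hT, Matrix.mul_assoc, hright k M 0 fun v => by simp [hQ0 k k' hk _ (hM.2 v)],
          Matrix.mul_zero]
      · rw [hT, hleft i M 0 fun v => by simp [hP0 i i' hi _ (hM.1 v)], Matrix.zero_mul]
  · rw [eq_top_iff]
    rintro M -
    have hPsum : ∑ i, LinearMap.toMatrix' (P i) = 1 := by
      rw [← map_sum, ← LinearMap.toMatrix'_id]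
      congr 1
      refine LinearMap.ext fun v => ?_
      simp [hPs]
    have hQsum : ∑ i, (LinearMap.toMatrix' (Q i)).transpose = 1 := by
      rw [← Matrix.transpose_sum, ← map_sum, ← Matrix.transpose_one, ← LinearMap.toMatrix'_id]
      congr 2
      refine LinearMap.ext fun v => ?_
      simp [hQs]
    have hM : M = ∑ x, T x M := by
      rw [Fintype.sum_prod_type]
      simp only [hT, ← Matrix.mul_sum, hQsum, Matrix.mul_one]
      rw [← Matrix.sum_mul, hPsum, Matrix.one_mul]
    rw [hM]
    refine Submodule.sum_mem _ fun x _ => Submodule.mem_iSup_of_mem x (mem_tensorSp.2 ⟨fun v => ?_,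
      fun v => ?_⟩)
    · rw [hT, Matrix.mul_assoc, ← Matrix.mulVec_mulVec, LinearMap.toMatrix'_mulVec]
      exact hPm _ _
    · rw [hT, Matrix.transpose_mul, Matrix.transpose_transpose, ← Matrix.mulVec_mulVec,
        LinearMap.toMatrix'_mulVec]
      exact hQm _ _

/-- `dim (U ⊗ V) = dim U · dim V`. -/
theorem finrank_tensorSp {p q : ℕ} (U : Submodule ℝ (Fin p → ℝ)) (V : Submodule ℝ (Fin q → ℝ)) :
    Module.finrank ℝ (tensorSp U V) = Module.finrank ℝ U * Module.finrank ℝ V := by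
  let u := Module.finBasis ℝ U
  let v := Module.finBasis ℝ V
  -- The columns of `A` and `B` are bases of `U` and `V`, so `M ↦ A M Bᵀ` is injective with range `U
  -- ⊗ V`.
  let A : Matrix (Fin p) (Fin (Module.finrank ℝ U)) ℝ :=
    LinearMap.toMatrix' (U.subtype ∘ₗ u.equivFun.symm.toLinearMap)
  let B : Matrix (Fin q) (Fin (Module.finrank ℝ V)) ℝ :=
    LinearMap.toMatrix' (V.subtype ∘ₗ v.equivFun.symm.toLinearMap)
  have hA : ∀ x, A.mulVec x = (u.equivFun.symm x : Fin p → ℝ) := fun x => by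
    simp [A, LinearMap.toMatrix'_mulVec]
  have hB : ∀ x, B.mulVec x = (v.equivFun.symm x : Fin q → ℝ) := fun x => by
    simp [B, LinearMap.toMatrix'_mulVec]
  have hcA : colSp A = U := by
    ext x
    constructor
    · rintro ⟨y, rfl⟩
      rw [Matrix.mulVecLin_apply, hA]
      exact (u.equivFun.symm y).2
    · intro hx
      exact ⟨u.equivFun ⟨x, hx⟩, by rw [Matrix.mulVecLin_apply, hA, LinearEquiv.symm_apply_apply]⟩
  have hcB : rowSp B.transpose = V := by
    rw [rowSp, Matrix.transpose_transpose]
    ext x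
    constructor
    · rintro ⟨y, rfl⟩
      rw [Matrix.mulVecLin_apply, hB]
      exact (v.equivFun.symm y).2
    · intro hx
      exact ⟨v.equivFun ⟨x, hx⟩, by rw [Matrix.mulVecLin_apply, hB, LinearEquiv.symm_apply_apply]⟩
  have hnA : (⊤ : Submodule ℝ _) ⊓ nullSp A = ⊥ := by
    rw [top_inf_eq, eq_bot_iff]
    intro x hx
    have h : A.mulVec x = 0 := hx
    rw [hA, ZeroMemClass.coe_eq_zero, LinearEquiv.map_eq_zero_iff] at h
    exact h
  have hnB : (⊤ : Submodule ℝ _) ⊓ nullSp B = ⊥ := by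
    rw [top_inf_eq, eq_bot_iff]
    intro x hx
    have h : B.mulVec x = 0 := hx
    rw [hB, ZeroMemClass.coe_eq_zero, LinearEquiv.map_eq_zero_iff] at h
    exact h
  let T : Matrix (Fin (Module.finrank ℝ U)) (Fin (Module.finrank ℝ V)) ℝ →ₗ[ℝ]
      Matrix (Fin p) (Fin q) ℝ :=
    { toFun := fun M => A * M * B.transpose
      map_add' := fun M N => by rw [Matrix.mul_add, Matrix.add_mul]
      map_smul' := fun c M => by rw [Matrix.mul_smul, Matrix.smul_mul, RingHom.id_apply] }
  have hr : LinearMap.range T = tensorSp U V := by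
    ext N
    have h := exists_mul_mul_eq A B.transpose N
    rw [hcA, hcB] at h
    exact h.symm
  have hi : Function.Injective T := by
    rw [injective_iff_map_eq_zero]
    intro M hM
    have h : A * (M * B.transpose) = 0 := by rw [← Matrix.mul_assoc]; exact hM
    have h' := congrArg Matrix.transpose (eq_zero_of_mul_eq_zero hnA (fun _ => trivial) h)
    rw [Matrix.transpose_mul, Matrix.transpose_transpose, Matrix.transpose_zero] at h'
    exact Matrix.transpose_eq_zero.1 (eq_zero_of_mul_eq_zero hnB (fun _ => trivial) h')
  rw [← hr, LinearMap.finrank_range_of_inj hi, Module.finrank_matrix]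
  simp

/-! ### The rank of the differential map -/

theorem subseqMat_mul {L : ℕ} {d : ℕ → ℕ} (θ : WeightSpace L d) {k j i : ℕ} (hij : i ≤ j)
    (hjk : j ≤ k) : subseqMat θ k j * subseqMat θ j i = subseqMat θ k i := by
  induction k, hjk using Nat.le_induction with
  | base => rw [subseqMat_self, Matrix.one_mul]
  | succ k hjk ih =>
    rw [subseqMat_succ θ hjk, subseqMat_succ θ (hij.trans hjk), Matrix.mul_assoc, ih]

theorem subseqMat_succ_self {L : ℕ} {d : ℕ → ℕ} (θ : WeightSpace L d) (n : ℕ) :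
    subseqMat θ (n + 1) n = factorMat θ n := by
  rw [subseqMat_succ θ le_rfl, subseqMat_self, Matrix.mul_one]

theorem subseqMat_succ_right {L : ℕ} {d : ℕ → ℕ} (θ : WeightSpace L d) {k i : ℕ} (h : i < k) :
    subseqMat θ k i = subseqMat θ k (i + 1) * factorMat θ i := by
  rw [← subseqMat_succ_self, subseqMat_mul θ (Nat.le_succ i) h]

theorem colSp_mul_le {p q r : ℕ} (A : Matrix (Fin p) (Fin q) ℝ) (B : Matrix (Fin q) (Fin r) ℝ) :
    colSp (A * B) ≤ colSp A := by
  rintro _ ⟨v, rfl⟩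
  exact ⟨B.mulVec v, by simp [Matrix.mulVec_mulVec]⟩

theorem rowSp_mul_le {p q r : ℕ} (A : Matrix (Fin p) (Fin q) ℝ) (B : Matrix (Fin q) (Fin r) ℝ) :
    rowSp (A * B) ≤ rowSp B := by
  rw [rowSp, Matrix.transpose_mul]
  exact colSp_mul_le _ _

theorem nullSp_le_mul {p q r : ℕ} (A : Matrix (Fin p) (Fin q) ℝ) (B : Matrix (Fin q) (Fin r) ℝ) :
    nullSp B ≤ nullSp (A * B) := by
  intro v hv
  have h : B.mulVec v = 0 := hv
  show (A * B).mulVec v = 0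
  rw [← Matrix.mulVec_mulVec, h, Matrix.mulVec_zero]

/-- The dimension of `∑ₘ Uₘ ⊗ Vₘ` for an increasing flag `U` and a decreasing flag `V`. -/
theorem finrank_iSup_tensorSp_flags {p q : ℕ} (U : ℕ → Submodule ℝ (Fin p → ℝ))
    (V : ℕ → Submodule ℝ (Fin q → ℝ)) (n : ℕ) (hU : ∀ m < n, U m ≤ U (m + 1))
    (hV : ∀ m < n, V (m + 1) ≤ V m) :
    (⨆ m ∈ Finset.range (n + 1), tensorSp (U m) (V m)) ≤ tensorSp (U n) ⊤ ∧
    Module.finrank ℝ (⨆ m ∈ Finset.range (n + 1), tensorSp (U m) (V m) : Submodule ℝ _) +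
      ∑ m ∈ Finset.range n, Module.finrank ℝ (U m) * Module.finrank ℝ (V (m + 1)) =
      ∑ m ∈ Finset.range (n + 1), Module.finrank ℝ (U m) * Module.finrank ℝ (V m) := by
  induction n with
  | zero =>
    have h0 : (⨆ m ∈ Finset.range (0 + 1), tensorSp (U m) (V m)) = tensorSp (U 0) (V 0) := by
      simp
    rw [h0, zero_add, Finset.sum_range_zero, add_zero, Finset.sum_range_one]
    exact ⟨tensorSp_mono le_rfl le_top, finrank_tensorSp _ _⟩
  | succ n ih =>
    obtain ⟨h1, h2⟩ := ih (fun m hm => hU m (Nat.lt_succ_of_lt hm))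
      (fun m hm => hV m (Nat.lt_succ_of_lt hm))
    have hU' := hU n (Nat.lt_succ_self n)
    have hV' := hV n (Nat.lt_succ_self n)
    have hS : (⨆ m ∈ Finset.range (n + 1 + 1), tensorSp (U m) (V m)) =
        (⨆ m ∈ Finset.range (n + 1), tensorSp (U m) (V m)) ⊔
          tensorSp (U (n + 1)) (V (n + 1)) := by
      rw [Finset.range_add_one, Finset.iSup_insert, sup_comm]
    -- The earlier sum lies in `U n ⊗ ⊤`, which bounds the overlap above; conversely, monotonicity
    -- puts `U n ⊗ V (n + 1)` both in the term of index `n` and in the new term.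
    have hI : (⨆ m ∈ Finset.range (n + 1), tensorSp (U m) (V m)) ⊓
          tensorSp (U (n + 1)) (V (n + 1)) = tensorSp (U n) (V (n + 1)) := by
      apply le_antisymm
      · refine (inf_le_inf_right _ h1).trans ?_
        rw [tensorSp_inf]
        exact tensorSp_mono inf_le_left inf_le_right
      · refine le_inf ((tensorSp_mono le_rfl hV').trans ?_) (tensorSp_mono hU' le_rfl)
        exact le_iSup₂ (f := fun m (_ : m ∈ Finset.range (n + 1)) => tensorSp (U m) (V m)) n
          (Finset.self_mem_range_succ n)
    rw [hS]
    refine ⟨sup_le (h1.trans (tensorSp_mono hU' le_rfl)) (tensorSp_mono le_rfl le_top), ?_⟩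
    have h := Submodule.finrank_sup_add_finrank_inf_eq
      (⨆ m ∈ Finset.range (n + 1), tensorSp (U m) (V m)) (tensorSp (U (n + 1)) (V (n + 1)))
    rw [hI, finrank_tensorSp, finrank_tensorSp] at h
    rw [Finset.sum_range_succ _ n, Finset.sum_range_succ _ (n + 1)]
    omega

theorem range_diffMap {L : ℕ} {d : ℕ → ℕ} (θ : WeightSpace L d) :
    LinearMap.range (diffMap θ).toLinearMap = ⨆ m ∈ Finset.range L,
      tensorSp (colSp (subseqMat θ L (m + 1))) (rowSp (subseqMat θ m 0)) := by
  apply le_antisymm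
  · rintro _ ⟨Δ, rfl⟩
    rw [ContinuousLinearMap.coe_coe, diffMap_apply]
    refine Submodule.sum_mem _ fun m _ => ?_
    refine Submodule.mem_iSup_of_mem (m : ℕ) (Submodule.mem_iSup_of_mem
      (Finset.mem_range.2 m.2) ?_)
    exact (exists_mul_mul_eq _ _ _).2 ⟨Δ m, rfl⟩
  · refine iSup₂_le fun m hm N hN => ?_
    obtain ⟨M, rfl⟩ := (exists_mul_mul_eq _ _ _).1 hN
    have hm' := Finset.mem_range.1 hm
    refine ⟨placeAt d m hm' M, ?_⟩
    rw [ContinuousLinearMap.coe_coe, diffMap_apply,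
      Finset.sum_eq_single_of_mem (⟨m, hm'⟩ : Fin L) (Finset.mem_univ _)]
    · simp [placeAt]
    · intro n _ hn
      simp [placeAt, Pi.single_eq_of_ne hn]

theorem finrank_colSp {p q : ℕ} (M : Matrix (Fin p) (Fin q) ℝ) :
    Module.finrank ℝ (colSp M) = M.rank := rfl

theorem finrank_rowSp {p q : ℕ} (M : Matrix (Fin p) (Fin q) ℝ) :
    Module.finrank ℝ (rowSp M) = M.rank := by
  rw [rowSp, finrank_colSp, Matrix.rank_transpose]

theorem sum_Icc_one_eq_sum_range (f : ℕ → ℤ) (n : ℕ) :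
    ∑ j ∈ Finset.Icc 1 n, f j = ∑ m ∈ Finset.range n, f (m + 1) := by
  induction n with
  | zero => simp
  | succ n ih => rw [Finset.sum_Icc_succ_top (by omega), Finset.sum_range_succ, ih]

theorem finrank_weightSpace (L : ℕ) (d : ℕ → ℕ) :
    Module.finrank ℝ (WeightSpace L d) = ∑ m ∈ Finset.range L, d (m + 1) * d m := by
  rw [Module.finrank_pi_fintype, Finset.sum_range]
  exact Finset.sum_congr rfl fun m _ => by simp [Module.finrank_matrix]

theorem finrank_ker_diffMap {L : ℕ} {d : ℕ → ℕ} (θ : WeightSpace L d) :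
    (Module.finrank ℝ (LinearMap.ker (diffMap θ).toLinearMap) : ℤ) =
      ∑ j ∈ Finset.Icc 1 L, (d j : ℤ) * (d (j - 1) : ℤ)
      - ∑ j ∈ Finset.Icc 1 L,
          ((subseqMat θ L j).rank : ℤ) * ((subseqMat θ (j - 1) 0).rank : ℤ)
      + ∑ j ∈ Finset.Icc 1 (L - 1),
          ((subseqMat θ L j).rank : ℤ) * ((subseqMat θ j 0).rank : ℤ) := by
  have hrk := LinearMap.finrank_range_add_finrank_ker (diffMap θ).toLinearMap
  rw [finrank_weightSpace, range_diffMap] at hrk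
  rw [sum_Icc_one_eq_sum_range, sum_Icc_one_eq_sum_range, sum_Icc_one_eq_sum_range]
  change _ = ∑ m ∈ Finset.range L, (d (m + 1) : ℤ) * (d m : ℤ)
    - ∑ m ∈ Finset.range L, ((subseqMat θ L (m + 1)).rank : ℤ) * ((subseqMat θ m 0).rank : ℤ)
    + ∑ m ∈ Finset.range (L - 1),
      ((subseqMat θ L (m + 1)).rank : ℤ) * ((subseqMat θ (m + 1) 0).rank : ℤ)
  cases L with
  -- Without matrices all sums are empty; the last one because `L - 1` truncates to `0`.
  | zero =>
    simp only [Finset.range_zero, Finset.sum_empty] at hrk ⊢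
    simp only [Nat.zero_sub, Finset.range_zero, Finset.sum_empty]
    omega
  | succ n =>
    have h := (finrank_iSup_tensorSp_flags (fun m => colSp (subseqMat θ (n + 1) (m + 1)))
      (fun m => rowSp (subseqMat θ m 0)) n
      (fun m hm => by
        rw [subseqMat_succ_right θ (show m + 1 < n + 1 by omega)]
        exact colSp_mul_le _ _)
      (fun m _ => by
        rw [subseqMat_succ θ (Nat.zero_le m)]
        exact rowSp_mul_le _ _)).2
    simp only [finrank_colSp, finrank_rowSp] at h
    zify at hrk h
    rw [Nat.add_sub_cancel]
    linarith

/-! ### Flow subspaces and flow prebasis subspaces as direct sum decompositions -/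

section Flow

variable {L : ℕ} {d : ℕ → ℕ} (θ : WeightSpace L d)

theorem nullSp_one (n : ℕ) : nullSp (1 : Matrix (Fin n) (Fin n) ℝ) = ⊥ := by
  simp [nullSp]

theorem colSp_one (n : ℕ) : colSp (1 : Matrix (Fin n) (Fin n) ℝ) = ⊤ := by
  simp [colSp]

theorem rowSp_one (n : ℕ) : rowSp (1 : Matrix (Fin n) (Fin n) ℝ) = ⊤ := by
  rw [rowSp, Matrix.transpose_one, colSp_one]

theorem nullSp_zero (p q : ℕ) : nullSp (0 : Matrix (Fin p) (Fin q) ℝ) = ⊤ := by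
  simp [nullSp]

theorem rowSp_zero (p q : ℕ) : rowSp (0 : Matrix (Fin p) (Fin q) ℝ) = ⊥ := by
  simp [rowSp, colSp]

/-- This convention makes `null W_{L+1∼j}` the whole layer and `row W_{L+1∼j}` zero, which closes
the flags for `a` at the top and for `b` at the bottom. -/
theorem subseqMat_succ_last {j : ℕ} (hj : j ≤ L) : subseqMat θ (L + 1) j = 0 := by
  rw [subseqMat_succ θ hj, factorMat, dif_neg (lt_irrefl L), Matrix.zero_mul]

theorem nullSp_subseqMat_mono {j k k' : ℕ} (hj : j ≤ k) (hk : k ≤ k') :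
    nullSp (subseqMat θ k j) ≤ nullSp (subseqMat θ k' j) := by
  rw [← subseqMat_mul θ hj hk]; exact nullSp_le_mul _ _

theorem colSp_subseqMat_mono {j i i' : ℕ} (hi : i ≤ i') (hj : i' ≤ j) :
    colSp (subseqMat θ j i) ≤ colSp (subseqMat θ j i') := by
  rw [← subseqMat_mul θ hi hj]; exact colSp_mul_le _ _

theorem rowSp_subseqMat_anti {j k k' : ℕ} (hj : j ≤ k) (hk : k ≤ k') :
    rowSp (subseqMat θ k' j) ≤ rowSp (subseqMat θ k j) := by
  rw [← subseqMat_mul θ hj hk]; exact rowSp_mul_le _ _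

theorem nullSp_subseqMat_transpose_anti {j i i' : ℕ} (hi : i ≤ i') (hj : i' ≤ j) :
    nullSp (subseqMat θ j i').transpose ≤ nullSp (subseqMat θ j i).transpose := by
  rw [← subseqMat_mul θ hi hj, Matrix.transpose_mul]; exact nullSp_le_mul _ _

theorem flowA_natCast (k j i : ℕ) :
    flowA θ k j i = nullSp (subseqMat θ (k + 1) j) ⊓ colSp (subseqMat θ j i) := by
  have h : ((k : ℤ) + 1).toNat = k + 1 := by omega
  rw [flowA, h, if_neg (by omega), Int.toNat_natCast]

theorem flowA_natCast_sub_one_left (k j i : ℕ) :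
    flowA θ ((k : ℤ) - 1) j i = nullSp (subseqMat θ k j) ⊓ colSp (subseqMat θ j i) := by
  rw [flowA, sub_add_cancel, Int.toNat_natCast, if_neg (by omega), Int.toNat_natCast]

theorem flowA_natCast_sub_one_right (k j i : ℕ) :
    flowA θ k j ((i : ℤ) - 1) = nullSp (subseqMat θ (k + 1) j) ⊓
      (if i = 0 then ⊥ else colSp (subseqMat θ j (i - 1))) := by
  have h : ((k : ℤ) + 1).toNat = k + 1 := by omega
  rw [flowA, h]
  by_cases hi : i = 0
  · rw [if_pos (by omega), if_pos hi]
  · have h' : ((i : ℤ) - 1).toNat = i - 1 := by omega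
    rw [if_neg (by omega), if_neg hi, h']

theorem flowB_succ_right (k j i : ℕ) :
    flowB θ k j (i + 1) = rowSp (subseqMat θ k j) ⊓ nullSp (subseqMat θ j i).transpose := by
  rw [flowB, if_neg (Nat.succ_ne_zero i), Nat.add_sub_cancel]

end Flow

namespace IsFlowPrebasis

variable {L : ℕ} {d : ℕ → ℕ} {θ : WeightSpace L d} {a b : LayerFamily d}

/-- The flags increase in `k` and `i`. They start from `null W_{j∼j} = 0` and `W_{j∼-1} = 0`, and
reach the whole layer at `k = L` and `i = j`. -/
theorem a_direct_sum (h : IsFlowPrebasis θ a b) {j : ℕ} (hj : j ≤ L) :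
    iSupIndep (fun x : Set.Icc j L × Set.Iic j => a x.1 j x.2) ∧
      ⨆ x : Set.Icc j L × Set.Iic j, a x.1 j x.2 = ⊤ := by
  let F : Set.Icc j L → Submodule ℝ (Fin (d j) → ℝ) := fun k => nullSp (subseqMat θ (k + 1) j)
  let F' : Set.Icc j L → Submodule ℝ (Fin (d j) → ℝ) := fun k => nullSp (subseqMat θ k j)
  let G : Set.Iic j → Submodule ℝ (Fin (d j) → ℝ) := fun i => colSp (subseqMat θ j i)
  let G' : Set.Iic j → Submodule ℝ (Fin (d j) → ℝ) := fun i =>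
    if (i : ℕ) = 0 then ⊥ else colSp (subseqMat θ j (i - 1))
  have hc : ∀ (k : Set.Icc j L) (i : Set.Iic j), a k j i ≤ F k ⊓ G i ∧
      a k j i ⊔ (F k ⊓ G' i ⊔ F' k ⊓ G i) = F k ⊓ G i ∧
      a k j i ⊓ (F k ⊓ G' i ⊔ F' k ⊓ G i) = ⊥ := fun k i => by
    have := h.mem_a k j i i.2 k.2.1 k.2.2
    rwa [flowA_natCast, flowA_natCast_sub_one_left, flowA_natCast_sub_one_right] at this
  constructor
  · refine iSupIndep_of_flags (F := F) (F' := F') (G := G) (G' := G') ?_ ?_ ?_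
      (fun p q => (hc p q).1) (fun p q => (hc p q).2.2)
    · intro p p' hp
      exact nullSp_subseqMat_mono θ (p.2.1.trans (Nat.le_succ _)) hp
    · intro q
      dsimp only [G, G']
      split_ifs
      · exact bot_le
      · exact colSp_subseqMat_mono θ (Nat.sub_le _ _) q.2
    · intro q q' hq
      have hq' : (q : ℕ) < q' := hq
      dsimp only [G, G']
      rw [if_neg (by omega)]
      exact colSp_subseqMat_mono θ (by omega) ((Nat.sub_le _ _).trans q'.2)
  · rw [eq_top_iff]
    have := inf_le_iSup_of_flags (c := fun x : Set.Icc j L × Set.Iic j => a x.1 j x.2)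
      (F := F) (F' := F') (G := G) (G' := G') ?_ ?_
      (fun p q => (hc p q).2.1) ⟨L, hj, le_rfl⟩ ⟨j, Set.mem_Iic.2 le_rfl⟩
    · refine le_trans ?_ this
      simp only [F, G]
      rw [subseqMat_succ_last θ hj, nullSp_zero, subseqMat_self, colSp_one, inf_top_eq]
    · rintro ⟨k, hk1, hk2⟩
      rcases eq_or_lt_of_le hk1 with rfl | hlt
      · left
        simp only [F']
        rw [subseqMat_self, nullSp_one]
      · right
        refine ⟨⟨k - 1, by omega, by omega⟩, Subtype.mk_lt_mk.2 (by omega), ?_⟩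
        simp only [F, F']
        rw [Nat.sub_add_cancel (by omega)]
    · rintro ⟨i, hi⟩
      have hi' : i ≤ j := hi
      by_cases h0 : i = 0
      · left
        simp only [G', if_pos h0]
      · right
        refine ⟨⟨i - 1, (Nat.sub_le _ _).trans hi'⟩, Subtype.mk_lt_mk.2 (by omega), ?_⟩
        simp only [G, G', if_neg h0]

theorem b_direct_sum (h : IsFlowPrebasis θ a b) {j : ℕ} (hj : j ≤ L) :
    iSupIndep (fun x : Set.Icc j L × Set.Iic j => b x.1 j x.2) ∧
      ⨆ x : Set.Icc j L × Set.Iic j, b x.1 j x.2 = ⊤ := by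
  -- For `b` both flags decrease in their index, hence the order duals: predecessors belong to `k +
  -- 1` and `i + 1`.
  let F : (Set.Icc j L)ᵒᵈ → Submodule ℝ (Fin (d j) → ℝ) := fun k =>
    rowSp (subseqMat θ (OrderDual.ofDual k).1 j)
  let F' : (Set.Icc j L)ᵒᵈ → Submodule ℝ (Fin (d j) → ℝ) := fun k =>
    rowSp (subseqMat θ ((OrderDual.ofDual k).1 + 1) j)
  let G : (Set.Iic j)ᵒᵈ → Submodule ℝ (Fin (d j) → ℝ) := fun i =>
    if (OrderDual.ofDual i).1 = 0 then ⊤ else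
      nullSp (subseqMat θ j ((OrderDual.ofDual i).1 - 1)).transpose
  let G' : (Set.Iic j)ᵒᵈ → Submodule ℝ (Fin (d j) → ℝ) := fun i =>
    nullSp (subseqMat θ j (OrderDual.ofDual i).1).transpose
  let c : (Set.Icc j L)ᵒᵈ × (Set.Iic j)ᵒᵈ → Submodule ℝ (Fin (d j) → ℝ) := fun x =>
    b (OrderDual.ofDual x.1).1 j (OrderDual.ofDual x.2).1
  let e : Set.Icc j L × Set.Iic j ≃ (Set.Icc j L)ᵒᵈ × (Set.Iic j)ᵒᵈ :=
    Equiv.prodCongr OrderDual.toDual OrderDual.toDual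
  have hc : ∀ (k : (Set.Icc j L)ᵒᵈ) (i : (Set.Iic j)ᵒᵈ), c (k, i) ≤ F k ⊓ G i ∧
      c (k, i) ⊔ (F k ⊓ G' i ⊔ F' k ⊓ G i) = F k ⊓ G i ∧
      c (k, i) ⊓ (F k ⊓ G' i ⊔ F' k ⊓ G i) = ⊥ := fun k i => by
    have := h.mem_b (OrderDual.ofDual k).1 j (OrderDual.ofDual i).1 (OrderDual.ofDual i).2
      (OrderDual.ofDual k).2.1 (OrderDual.ofDual k).2.2
    rwa [flowB_succ_right] at this
  have hind : iSupIndep c := by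
    refine iSupIndep_of_flags (F := F) (F' := F') (G := G) (G' := G') ?_ ?_ ?_
      (fun p q => (hc p q).1) (fun p q => (hc p q).2.2)
    · intro p p' hp
      exact rowSp_subseqMat_anti θ ((OrderDual.ofDual p').2.1.trans (Nat.le_succ _)) hp
    · intro q
      dsimp only [G, G']
      split_ifs
      · exact le_top
      · exact nullSp_subseqMat_transpose_anti θ (Nat.sub_le _ _) (OrderDual.ofDual q).2
    · intro q q' hq
      have hq' : (OrderDual.ofDual q').1 < (OrderDual.ofDual q).1 := hq
      dsimp only [G, G']
      rw [if_neg (by omega)]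
      exact nullSp_subseqMat_transpose_anti θ (by omega)
        ((Nat.sub_le _ _).trans (OrderDual.ofDual q).2)
  have hspan : ⨆ x, c x = ⊤ := by
    rw [eq_top_iff]
    have := inf_le_iSup_of_flags (c := c) (F := F) (F' := F') (G := G) (G' := G') ?_ ?_
      (fun p q => (hc p q).2.1) (OrderDual.toDual ⟨j, le_rfl, hj⟩)
      (OrderDual.toDual ⟨0, Nat.zero_le j⟩)
    · refine le_trans ?_ this
      simp only [F, G, OrderDual.ofDual_toDual]
      rw [subseqMat_self, rowSp_one, if_pos trivial, inf_top_eq]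
    · intro k
      have hk := (OrderDual.ofDual k).2
      rcases eq_or_lt_of_le hk.2 with heq | hlt
      · left
        simp only [F']
        rw [heq, subseqMat_succ_last θ hj, rowSp_zero]
      · right
        refine ⟨OrderDual.toDual ⟨(OrderDual.ofDual k).1 + 1, hk.1.trans (Nat.le_succ _), hlt⟩,
          ?_, rfl⟩
        exact OrderDual.toDual_lt.2 (Nat.lt_succ_self _)
    · intro i
      have hi : (OrderDual.ofDual i).1 ≤ j := (OrderDual.ofDual i).2
      rcases eq_or_lt_of_le hi with heq | hlt
      · left
        simp only [G']
        rw [heq, subseqMat_self, Matrix.transpose_one, nullSp_one]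
      · right
        refine ⟨OrderDual.toDual ⟨(OrderDual.ofDual i).1 + 1, Set.mem_Iic.2 hlt⟩,
          OrderDual.toDual_lt.2 (Nat.lt_succ_self _), ?_⟩
        exact (if_neg (Nat.succ_ne_zero _)).symm
  exact ⟨hind.comp e.injective, (Equiv.iSup_comp (g := c) e).trans hspan⟩

/-- A vector of `a_{kji}` killed by `W_{k∼j}` lies in `A_{k-1,j,i}`, to which `a_{kji}` is
complementary. -/
theorem a_inf_nullSp (h : IsFlowPrebasis θ a b) {k j i : ℕ} (hi : i ≤ j) (hj : j ≤ k)
    (hk : k ≤ L) : a k j i ⊓ nullSp (subseqMat θ k j) = ⊥ := by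
  obtain ⟨h1, -, h3⟩ := h.mem_a k j i hi hj hk
  rw [flowA_natCast] at h1
  rw [flowA_natCast_sub_one_left] at h3
  rw [eq_bot_iff, ← h3]
  exact le_inf inf_le_left ((le_inf inf_le_right (inf_le_left.trans (h1.trans inf_le_right))).trans
    le_sup_right)

theorem b_inf_nullSp (h : IsFlowPrebasis θ a b) {k j i : ℕ} (hi : i ≤ j) (hj : j ≤ k)
    (hk : k ≤ L) : b k j i ⊓ nullSp (subseqMat θ j i).transpose = ⊥ := by
  obtain ⟨h1, -, h3⟩ := h.mem_b k j i hi hj hk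
  rw [flowB_succ_right] at h3
  rw [eq_bot_iff, ← h3]
  exact le_inf inf_le_left ((le_inf (inf_le_left.trans (h1.trans inf_le_left)) inf_le_right).trans
    le_sup_left)

/-- `W_{j∼i}ᵀ` is injective on `b_{kji}` and factors through `W_jᵀ`. This is what recovers `H` from
`H W_j`. -/
theorem b_inf_nullSp_factorMat (h : IsFlowPrebasis θ a b) {k n i : ℕ} (hi : i ≤ n)
    (hn : n + 1 ≤ k) (hk : k ≤ L) : b k (n + 1) i ⊓ nullSp (factorMat θ n).transpose = ⊥ := by
  rw [eq_bot_iff, ← h.b_inf_nullSp (hi.trans (Nat.le_succ n)) hn hk, subseqMat_succ θ hi,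
    Matrix.transpose_mul]
  exact inf_le_inf_left _ (nullSp_le_mul _ _)

/-- `W_{k+1∼j}` already kills `a_{kji}`. Hence a one-matrix subspace with `l < L` is killed by left
multiplication; `b_le_nullSp` is the dual for `h > 0`. -/
theorem a_le_nullSp (h : IsFlowPrebasis θ a b) {k j i : ℕ} (hi : i ≤ j) (hj : j ≤ k)
    (hk : k < L) : a k j i ≤ nullSp (subseqMat θ L j) := by
  have h1 := (h.mem_a k j i hi hj hk.le).1
  rw [flowA_natCast] at h1
  exact h1.trans (inf_le_left.trans (nullSp_subseqMat_mono θ (hj.trans (Nat.le_succ k)) hk))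

theorem b_le_nullSp (h : IsFlowPrebasis θ a b) {k j i : ℕ} (hi : i ≤ j) (hi0 : 0 < i)
    (hj : j ≤ k) (hk : k ≤ L) : b k j i ≤ nullSp (subseqMat θ j 0).transpose := by
  have h1 := (h.mem_b k j i hi hj hk).1
  rw [flowB, if_neg (by omega)] at h1
  exact h1.trans (inf_le_right.trans (nullSp_subseqMat_transpose_anti θ (Nat.zero_le _) (by omega)))

theorem map_a (h : IsFlowPrebasis θ a b) {k j j' i : ℕ} (hi : i ≤ j) (hj : j ≤ j')
    (hj' : j' ≤ k) (hk : k ≤ L) :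
    (a k j i).map (subseqMat θ j' j).mulVecLin = a k j' i := by
  induction j', hj using Nat.le_induction with
  | base => rw [subseqMat_self, Matrix.mulVecLin_one, Submodule.map_id]
  | succ n hn ih =>
    rw [subseqMat_succ θ hn, Matrix.mulVecLin_mul, Submodule.map_comp, ih (by omega),
      ← h.flow_a k n i (hi.trans hn) hj' hk]

theorem map_b (h : IsFlowPrebasis θ a b) {k j j' i : ℕ} (hi : i ≤ j) (hj : j ≤ j')
    (hj' : j' ≤ k) (hk : k ≤ L) :
    (b k j' i).map (subseqMat θ j' j).transpose.mulVecLin = b k j i := by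
  induction j', hj using Nat.le_induction with
  | base => rw [subseqMat_self, Matrix.transpose_one, Matrix.mulVecLin_one, Submodule.map_id]
  | succ n hn ih =>
    rw [subseqMat_succ θ hn, Matrix.transpose_mul, Matrix.mulVecLin_mul, Submodule.map_comp,
      ← h.flow_b k n i (hi.trans hn) hj' hk, ih (by omega)]

end IsFlowPrebasis

/-! ### The one-matrix decomposition of the weight space -/

/-- The indices `(k, i)` of the flow prebasis subspaces of layer `j`. -/
abbrev LayerIndex (L j : ℕ) : Type := Set.Icc j L × Set.Iic j

/-- The indices `(n, (l, i), (k, h))` of the one-matrix subspaces `φ_{l,k,n+1,i,h}`. -/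
abbrev OneMatrixIndex (L : ℕ) : Type := Σ n : Fin L, LayerIndex L (n + 1) × LayerIndex L n

/-- The one-matrix subspaces as a family. -/
def oneMatrixFam {L : ℕ} {d : ℕ → ℕ} (a b : LayerFamily d) (x : OneMatrixIndex L) :
    Submodule ℝ (WeightSpace L d) :=
  oneMatrixSp a b x.2.1.1 x.2.2.1 x.1 x.2.1.2 x.2.2.2 x.1.2

open Classical in
/-- The family in which `φ_{l,k,n+1,i,h}` is replaced by `τ_{l,k,n+1,i,h}`, where the latter is
defined, for all `(l, k, i, h)` with `Q l k i h`. -/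
noncomputable def tradedFam {L : ℕ} {d : ℕ → ℕ} (θ : WeightSpace L d) (a b : LayerFamily d)
    (Q : ℕ → ℕ → ℕ → ℕ → Prop) (x : OneMatrixIndex L) : Submodule ℝ (WeightSpace L d) :=
  -- The two inequalities `l > j` and `k ≥ j` are all that the index range of `τ` demands beyond
  -- that of `φ`.
  if h : Q x.2.1.1 x.2.2.1 x.2.1.2 x.2.2.2 ∧ x.1 + 1 < (x.2.1.1 : ℕ) ∧ x.1 + 1 ≤ (x.2.2.1 : ℕ) then
    twoMatrixSp θ a b x.2.1.1 x.2.2.1 x.1 x.2.1.2 x.2.2.2 (h.2.1.trans_le x.2.1.1.2.2)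
  else oneMatrixFam a b x

theorem placeAt_apply_self {L : ℕ} (d : ℕ → ℕ) (n : ℕ) (hn : n < L)
    (M : Matrix (Fin (d (n + 1))) (Fin (d n)) ℝ) : placeAt d n hn M ⟨n, hn⟩ = M := by
  simp [placeAt]

theorem placeAt_apply_of_ne {L : ℕ} (d : ℕ → ℕ) {n m : ℕ} (hn : n < L) (hm : m < L) (h : m ≠ n)
    (M : Matrix (Fin (d (n + 1))) (Fin (d n)) ℝ) : placeAt d n hn M ⟨m, hm⟩ = 0 := by
  have h' : (⟨m, hm⟩ : Fin L) ≠ ⟨n, hn⟩ := fun e => h (congrArg Fin.val e)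
  simp [placeAt, Pi.single_eq_of_ne h']

theorem diffMap_placeAt {L : ℕ} {d : ℕ → ℕ} (θ : WeightSpace L d) {n : ℕ} (hn : n < L)
    (M : Matrix (Fin (d (n + 1))) (Fin (d n)) ℝ) :
    diffMap θ (placeAt d n hn M) = subseqMat θ L (n + 1) * M * subseqMat θ n 0 := by
  rw [diffMap_apply, Finset.sum_eq_single_of_mem (⟨n, hn⟩ : Fin L) (Finset.mem_univ _),
    placeAt_apply_self]
  rintro ⟨m, hm⟩ - hne
  rw [placeAt_apply_of_ne d hn hm fun e => hne (Fin.ext e), Matrix.mul_zero, Matrix.zero_mul]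

/-- The two slots contribute `W_{L∼j} H W_{j∼0}` with opposite signs. -/
theorem diffMap_twoMatrixMap {L : ℕ} {d : ℕ → ℕ} (θ : WeightSpace L d) {n : ℕ} (hn : n + 1 < L)
    (H : Matrix (Fin (d (n + 1))) (Fin (d (n + 1))) ℝ) :
    diffMap θ (twoMatrixMap θ n hn H) = 0 := by
  change diffMap θ (placeAt d (n + 1) hn (factorMat θ (n + 1) * H)
    + placeAt d n (Nat.lt_of_succ_lt hn) (-(H * factorMat θ n))) = 0
  rw [map_add, diffMap_placeAt, diffMap_placeAt, ← Matrix.mul_assoc,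
    ← subseqMat_succ_right θ hn, subseqMat_succ θ (Nat.zero_le n)]
  simp only [Matrix.mul_neg, Matrix.neg_mul, Matrix.mul_assoc, add_neg_cancel]

/-- In each slot, the decomposition of layer `j` by the `a` and that of layer `j - 1` by the `b` are
tensored. -/
theorem iSupIndep_oneMatrixFam_and_iSup {L : ℕ} {d : ℕ → ℕ} {θ : WeightSpace L d}
    {a b : LayerFamily d} (hab : IsFlowPrebasis θ a b) :
    iSupIndep (oneMatrixFam a b : OneMatrixIndex L → _) ∧
      ⨆ x : OneMatrixIndex L, oneMatrixFam a b x = ⊤ := by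
  let S : (n : Fin L) → LayerIndex L (n + 1) × LayerIndex L n →
      Submodule ℝ (Matrix (Fin (d (n + 1))) (Fin (d n)) ℝ) := fun n x =>
    tensorSp (a x.1.1 (n + 1) x.1.2) (b x.2.1 n x.2.2)
  have h : ∀ n : Fin L, iSupIndep (S n) ∧ ⨆ x, S n x = ⊤ := fun n =>
    iSupIndep_tensorSp (hab.a_direct_sum (Nat.succ_le_of_lt n.2)).1
      (hab.a_direct_sum (Nat.succ_le_of_lt n.2)).2 (hab.b_direct_sum n.2.le).1
      (hab.b_direct_sum n.2.le).2
  have h1 := iSupIndep_sigma_single (S := S) (fun n => (h n).1) fun n => (h n).2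
  have h2 := iSup_sigma_single (S := S) fun n => (h n).2
  exact ⟨h1, h2⟩

namespace IsFlowPrebasis

variable {L : ℕ} {d : ℕ → ℕ} {θ : WeightSpace L d} {a b : LayerFamily d}

theorem factorMat_mul_mem (hab : IsFlowPrebasis θ a b) {l n i : ℕ} (hi : i ≤ n) (hn : n + 1 ≤ l)
    (hl : l ≤ L) {r : ℕ} {V : Submodule ℝ (Fin r → ℝ)} {H : Matrix (Fin (d n)) (Fin r) ℝ}
    (hH : H ∈ tensorSp (a l n i) V) : factorMat θ n * H ∈ tensorSp (a l (n + 1) i) V := by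
  have h := mul_mem_tensorSp (factorMat θ n) (1 : Matrix (Fin r) (Fin r) ℝ) hH
  rwa [Matrix.mul_one, Matrix.transpose_one, Matrix.mulVecLin_one, Submodule.map_id,
    ← hab.flow_a l n i hi hn hl] at h

theorem mul_factorMat_mem (hab : IsFlowPrebasis θ a b) {k n h : ℕ} (hh : h ≤ n) (hn : n + 1 ≤ k)
    (hk : k ≤ L) {r : ℕ} {U : Submodule ℝ (Fin r → ℝ)} {H : Matrix (Fin r) (Fin (d (n + 1))) ℝ}
    (hH : H ∈ tensorSp U (b k (n + 1) h)) : H * factorMat θ n ∈ tensorSp U (b k n h) := by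
  have h := mul_mem_tensorSp (1 : Matrix (Fin r) (Fin r) ℝ) (factorMat θ n) hH
  rwa [Matrix.one_mul, Matrix.mulVecLin_one, Submodule.map_id,
    ← hab.flow_b k n _ hh hn hk] at h

theorem eq_zero_of_mul_factorMat_eq_zero (hab : IsFlowPrebasis θ a b) {k n h : ℕ} (hh : h ≤ n)
    (hn : n + 1 ≤ k) (hk : k ≤ L) {r : ℕ} {U : Submodule ℝ (Fin r → ℝ)}
    {H : Matrix (Fin r) (Fin (d (n + 1))) ℝ} (hH : H ∈ tensorSp U (b k (n + 1) h))
    (h0 : H * factorMat θ n = 0) : H = 0 := by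
  apply Matrix.transpose_eq_zero.1
  refine eq_zero_of_mul_eq_zero (hab.b_inf_nullSp_factorMat hh hn hk) (mem_tensorSp.1 hH).2 ?_
  rw [← Matrix.transpose_mul, h0, Matrix.transpose_zero]

end IsFlowPrebasis

theorem placeAt_mem_iSup_oneMatrixFam {L : ℕ} {d : ℕ → ℕ} {a b : LayerFamily d} {m l k n i h : ℕ}
    (hm : m < n) (hn : n < L) (hnl : n + 1 ≤ l) (hl : l ≤ L) (hi : i ≤ n + 1) (hnk : n ≤ k)
    (hk : k ≤ L) (hh : h ≤ n) {M : Matrix (Fin (d (n + 1))) (Fin (d n)) ℝ}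
    (hM : M ∈ tensorSp (a l (n + 1) i) (b k n h)) :
    placeAt d n hn M ∈ ⨆ (y : OneMatrixIndex L) (_ : m < y.1), oneMatrixFam a b y := by
  let y : OneMatrixIndex L :=
    ⟨⟨n, hn⟩, (⟨l, hnl, hl⟩, ⟨i, hi⟩), (⟨k, hnk, hk⟩, ⟨h, hh⟩)⟩
  exact Submodule.mem_iSup_of_mem y (Submodule.mem_iSup_of_mem hm ⟨M, hM, rfl⟩)

/-! ### Exchanging one-matrix for two-matrix subspaces -/

section Traded

variable {L : ℕ} {d : ℕ → ℕ} {θ : WeightSpace L d} {a b : LayerFamily d}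
  (Q : ℕ → ℕ → ℕ → ℕ → Prop)

/-- `-H W_j` stays in `φ_{lkjih}`, while `W_{j+1} H` lies in `φ_{l,k,j+1,i,h}`, one slot higher. -/
theorem tradedFam_le (hab : IsFlowPrebasis θ a b) (x : OneMatrixIndex L) :
    tradedFam θ a b Q x ≤
      oneMatrixFam a b x ⊔ ⨆ (y : OneMatrixIndex L) (_ : (x.1 : ℕ) < y.1), oneMatrixFam a b y := by
  obtain ⟨⟨n, hn⟩, ⟨⟨l, hnl, hl⟩, ⟨i, hi⟩⟩, ⟨⟨k, hnk, hk⟩, ⟨h, hh⟩⟩⟩ := x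
  rw [tradedFam]
  split_ifs with hQ
  · obtain ⟨-, hnl', hnk'⟩ := hQ
    rintro _ ⟨H, hH, rfl⟩
    refine Submodule.add_mem _ (Submodule.mem_sup_right ?_) (Submodule.mem_sup_left ?_)
    · exact placeAt_mem_iSup_oneMatrixFam (Nat.lt_succ_self n) _ hnl' hl (hi.trans (Nat.le_succ _))
        hnk' hk (hh.trans (Nat.le_succ _)) (hab.factorMat_mul_mem hi hnl' hl hH)
    · exact ⟨_, Submodule.neg_mem _ (hab.mul_factorMat_mem hh hnk' hk hH), rfl⟩
  · exact le_sup_left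

theorem oneMatrixFam_le (hab : IsFlowPrebasis θ a b) (x : OneMatrixIndex L) :
    oneMatrixFam a b x ≤ tradedFam θ a b Q x ⊔
      ⨆ (y : OneMatrixIndex L) (_ : (x.1 : ℕ) < y.1), oneMatrixFam a b y := by
  obtain ⟨⟨n, hn⟩, ⟨⟨l, hnl, hl⟩, ⟨i, hi⟩⟩, ⟨⟨k, hnk, hk⟩, ⟨h, hh⟩⟩⟩ := x
  rw [tradedFam]
  split_ifs with hQ
  · obtain ⟨-, hnl', hnk'⟩ := hQ
    rintro _ ⟨M, hM, rfl⟩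
    have hM' : M ∈ tensorSp (a l (n + 1) i) (b k n h) := hM
    -- Since `b_{k,j-1,h} = W_jᵀ b_{kjh}`, every `M` in the slot of `W_j` is of the form `H W_j`.
    rw [hab.flow_b k n h hh hnk' hk] at hM'
    obtain ⟨H, hH, rfl⟩ := exists_mul_eq_of_mem_tensorSp _ hM'
    have hn' : n + 1 < L := lt_of_lt_of_le hnl' hl
    have heq : placeAt d n hn (H * factorMat θ n) =
        -twoMatrixMap θ n hn' H + placeAt d (n + 1) hn' (factorMat θ (n + 1) * H) := by
      change _ = -(placeAt d (n + 1) hn' (factorMat θ (n + 1) * H) +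
        placeAt d n hn (-(H * factorMat θ n))) + _
      rw [map_neg]
      abel
    change placeAt d n hn (H * factorMat θ n) ∈ _
    rw [heq]
    refine Submodule.add_mem _ (Submodule.mem_sup_left ?_) (Submodule.mem_sup_right ?_)
    · exact Submodule.neg_mem _ ⟨H, hH, rfl⟩
    · exact placeAt_mem_iSup_oneMatrixFam (Nat.lt_succ_self n) _ hnl' hl (hi.trans (Nat.le_succ _))
        hnk' hk (hh.trans (Nat.le_succ _)) (hab.factorMat_mul_mem hi hnl' hl hH)
  · exact le_sup_left

theorem tradedFam_inf_iSup (hab : IsFlowPrebasis θ a b) (x : OneMatrixIndex L) :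
    tradedFam θ a b Q x ⊓
      ⨆ (y : OneMatrixIndex L) (_ : (x.1 : ℕ) < y.1), oneMatrixFam a b y = ⊥ := by
  -- All one-matrix subspaces of higher slots vanish in the slot of `x`, so it suffices to look at
  -- that component.
  have hker : (⨆ (y : OneMatrixIndex L) (_ : (x.1 : ℕ) < y.1), oneMatrixFam a b y) ≤
      LinearMap.ker (LinearMap.proj (R := ℝ)
        (φ := fun m : Fin L => Matrix (Fin (d (m + 1))) (Fin (d m)) ℝ) x.1) := by
    refine iSup₂_le fun y hy => ?_
    rintro _ ⟨M, -, rfl⟩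
    exact placeAt_apply_of_ne d y.1.2 x.1.2 hy.ne M
  rw [eq_bot_iff]
  refine (inf_le_inf_left _ hker).trans ?_
  obtain ⟨⟨n, hn⟩, ⟨⟨l, hnl, hl⟩, ⟨i, hi⟩⟩, ⟨⟨k, hnk, hk⟩, ⟨h, hh⟩⟩⟩ := x
  rw [tradedFam]
  split_ifs with hQ
  · obtain ⟨-, hnl', hnk'⟩ := hQ
    rintro _ ⟨⟨H, hH, rfl⟩, h0⟩
    have hn' : n + 1 < L := lt_of_lt_of_le hnl' hl
    have h1 : placeAt d (n + 1) hn' (factorMat θ (n + 1) * H) ⟨n, hn⟩ +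
        placeAt d n hn (-(H * factorMat θ n)) ⟨n, hn⟩ = 0 := h0
    rw [placeAt_apply_of_ne d hn' hn (by omega), placeAt_apply_self, zero_add, neg_eq_zero] at h1
    rw [hab.eq_zero_of_mul_factorMat_eq_zero hh hnk' hk hH h1, map_zero]
    exact Submodule.zero_mem _
  · rintro _ ⟨⟨M, hM, rfl⟩, h0⟩
    have h1 : placeAt d n hn M ⟨n, hn⟩ = 0 := h0
    rw [placeAt_apply_self] at h1
    rw [h1, map_zero]
    exact Submodule.zero_mem _

theorem iSupIndep_tradedFam (hab : IsFlowPrebasis θ a b) : iSupIndep (tradedFam θ a b Q) :=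
  iSupIndep_of_triangular (fun x => x.1) (iSupIndep_oneMatrixFam_and_iSup hab).1
    (tradedFam_le Q hab) (tradedFam_inf_iSup Q hab)

theorem iSup_tradedFam (hab : IsFlowPrebasis θ a b) : ⨆ x, tradedFam θ a b Q x = ⊤ := by
  rw [eq_top_iff, ← (iSupIndep_oneMatrixFam_and_iSup hab).2]
  exact iSup_le_iSup_of_triangular (fun x => x.1) (N := L) (fun x => x.1.2.le)
    (oneMatrixFam_le Q hab)

/-- The indices of the one-matrix subspaces `φ_{L,k,n+1,i,0}` for which `τ_{L,k,n+1,i,0}` is not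
defined. -/
def IsTopL0 (x : OneMatrixIndex L) : Prop :=
  (x.2.1.1 : ℕ) = L ∧ (x.2.2.2 : ℕ) = 0 ∧ ¬(x.1 + 1 < (x.2.1.1 : ℕ) ∧ x.1 + 1 ≤ (x.2.2.1 : ℕ))

theorem tradedFam_of_isTopL0 {x : OneMatrixIndex L} (hx : IsTopL0 x) :
    tradedFam θ a b Q x = oneMatrixFam a b x := by
  rw [tradedFam, dif_neg fun h => hx.2.2 h.2]

theorem tradedFam_le_ker (hQ : ∀ l k i h, l = L → h = 0 → Q l k i h) (hab : IsFlowPrebasis θ a b)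
    {x : OneMatrixIndex L} (hx : ¬IsTopL0 x) :
    tradedFam θ a b Q x ≤ LinearMap.ker (diffMap θ).toLinearMap := by
  obtain ⟨⟨n, hn⟩, ⟨⟨l, hnl, hl⟩, ⟨i, hi⟩⟩, ⟨⟨k, hnk, hk⟩, ⟨h, hh⟩⟩⟩ := x
  rw [tradedFam]
  split_ifs with hQ'
  · rintro _ ⟨H, -, rfl⟩
    exact diffMap_twoMatrixMap θ _ H
  · rintro _ ⟨M, hM, rfl⟩
    change diffMap θ (placeAt d n hn M) = 0
    rw [diffMap_placeAt]
    obtain ⟨h1, h2⟩ := mem_tensorSp.1 hM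
    by_cases hl' : l < L
    · have : subseqMat θ L (n + 1) * M = 0 := Matrix.mulVec_injective (funext fun v => by
        rw [← Matrix.mulVec_mulVec, Matrix.zero_mulVec]
        exact hab.a_le_nullSp hi hnl hl' (h1 v))
      rw [this, Matrix.zero_mul]
    -- With `l = L` and `h = 0` the index is in `Q`; not being exchanged, it would satisfy
    -- `IsTopL0`.
    · have hh' : 0 < h := by
        rw [Nat.pos_iff_ne_zero]
        intro h0
        have hlL : l = L := by omega
        exact hx ⟨hlL, h0, fun ht => hQ' ⟨hQ _ _ _ _ hlL h0, ht⟩⟩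
      have : M * subseqMat θ n 0 = 0 :=
        Matrix.transpose_injective (Matrix.mulVec_injective (funext fun v => by
          rw [Matrix.transpose_mul, ← Matrix.mulVec_mulVec, Matrix.transpose_zero,
            Matrix.zero_mulVec]
          exact hab.b_le_nullSp hh hh' hnk hk (h2 v)))
      rw [Matrix.mul_assoc, this, Matrix.mul_zero]

/-- `dμ(θ)` maps `φ_{Lkji0}` injectively into `a_{LLi} ⊗ b_{k00}`, and among the exceptional indices
the pair `(i, k)` determines `j`; so the images are independent. -/
theorem iSup_isTopL0_inf_ker (hab : IsFlowPrebasis θ a b) :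
    (⨆ x : {x : OneMatrixIndex L // IsTopL0 x}, oneMatrixFam a b x.1) ⊓
      LinearMap.ker (diffMap θ).toLinearMap = ⊥ := by
  let e : {x : OneMatrixIndex L // IsTopL0 x} → LayerIndex L L × LayerIndex L 0 := fun x =>
    ((⟨L, le_rfl, le_rfl⟩, ⟨x.1.2.1.2, (Set.mem_Iic.1 x.1.2.1.2.2).trans x.1.1.2⟩),
      (⟨x.1.2.2.1, Nat.zero_le _, x.1.2.2.1.2.2⟩, ⟨0, Set.mem_Iic.2 le_rfl⟩))
  have he : Function.Injective e := by
    rintro ⟨⟨⟨n, hn⟩, ⟨⟨l, hnl, hl⟩, ⟨i, hi⟩⟩, ⟨⟨k, hnk, hk⟩, ⟨h, hh⟩⟩⟩, h1, h2, h3⟩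
      ⟨⟨⟨n', hn'⟩, ⟨⟨l', hnl', hl'⟩, ⟨i', hi'⟩⟩, ⟨⟨k', hnk', hk'⟩, ⟨h', hh'⟩⟩⟩, h1', h2', h3'⟩ heq
    dsimp only at h1 h2 h3 h1' h2' h3'
    obtain rfl : i = i' := congrArg (fun y => (y.1.2 : ℕ)) heq
    obtain rfl : k = k' := congrArg (fun y => (y.2.1 : ℕ)) heq
    -- Since `n ≤ k` and `n < L`, the absence of a `τ` forces `n = min k (L - 1)`.
    obtain rfl : n = n' := by
      change n ≤ k at hnk
      change n' ≤ k at hnk'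
      omega
    subst h1 h2 h2'
    obtain rfl := h1'
    rfl
  have hS := (iSupIndep_tensorSp (hab.a_direct_sum (le_refl L)).1
    (hab.a_direct_sum (le_refl L)).2 (hab.b_direct_sum (Nat.zero_le L)).1
    (hab.b_direct_sum (Nat.zero_le L)).2).1.comp he
  refine iSup_inf_ker_eq_bot (diffMap θ).toLinearMap ?_ ?_ hS
  · rintro ⟨⟨⟨n, hn⟩, ⟨⟨l, hnl, hl⟩, ⟨i, hi⟩⟩, ⟨⟨k, hnk, hk⟩, ⟨h, hh⟩⟩⟩, h1, h2, h3⟩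
    dsimp only at h1 h2
    subst h2
    rw [eq_bot_iff]
    rintro _ ⟨⟨M, hM, rfl⟩, h0⟩
    have hM' : M ∈ tensorSp (a L (n + 1) i) (b k n 0) := h1 ▸ hM
    change diffMap θ (placeAt d n hn M) = 0 at h0
    rw [diffMap_placeAt, Matrix.mul_assoc] at h0
    have hMB : M * subseqMat θ n 0 = 0 := by
      refine eq_zero_of_mul_eq_zero (hab.a_inf_nullSp hi hn le_rfl) (fun v => ?_) h0
      rw [← Matrix.mulVec_mulVec]
      exact (mem_tensorSp.1 hM').1 _
    have hM0 : M = 0 := by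
      apply Matrix.transpose_eq_zero.1
      refine eq_zero_of_mul_eq_zero (hab.b_inf_nullSp hh hnk hk) (mem_tensorSp.1 hM').2 ?_
      rw [← Matrix.transpose_mul, hMB, Matrix.transpose_zero]
    rw [hM0, map_zero]
    exact Submodule.zero_mem _
  · rintro ⟨⟨⟨n, hn⟩, ⟨⟨l, hnl, hl⟩, ⟨i, hi⟩⟩, ⟨⟨k, hnk, hk⟩, ⟨h, hh⟩⟩⟩, h1, h2, h3⟩ _ ⟨M, hM, rfl⟩
    dsimp only at h1 h2
    subst h2
    have hM' : M ∈ tensorSp (a L (n + 1) i) (b k n 0) := h1 ▸ hM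
    have h := mul_mem_tensorSp (subseqMat θ L (n + 1)) (subseqMat θ n 0) hM'
    rw [hab.map_a hi hn le_rfl le_rfl, hab.map_b (le_refl 0) (Nat.zero_le n) hnk hk] at h
    change diffMap θ (placeAt d n hn M) ∈ _
    rw [diffMap_placeAt]
    exact h

theorem iSup_tradedFam_eq_ker (hQ : ∀ l k i h, l = L → h = 0 → Q l k i h)
    (hab : IsFlowPrebasis θ a b) :
    ⨆ x : {x : OneMatrixIndex L // ¬IsTopL0 x}, tradedFam θ a b Q x.1 =
      LinearMap.ker (diffMap θ).toLinearMap := by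
  have hle : ⨆ x : {x : OneMatrixIndex L // ¬IsTopL0 x}, tradedFam θ a b Q x.1 ≤
      LinearMap.ker (diffMap θ).toLinearMap := iSup_le fun x => tradedFam_le_ker Q hQ hab x.2
  have htop : (⨆ x : {x : OneMatrixIndex L // ¬IsTopL0 x}, tradedFam θ a b Q x.1) ⊔
      (⨆ x : {x : OneMatrixIndex L // IsTopL0 x}, oneMatrixFam a b x.1) = ⊤ := by
    rw [eq_top_iff, ← iSup_tradedFam Q hab]
    refine iSup_le fun x => ?_
    by_cases hx : IsTopL0 x
    · rw [tradedFam_of_isTopL0 Q hx]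
      exact (le_iSup (fun x : {x : OneMatrixIndex L // IsTopL0 x} => oneMatrixFam a b x.1)
        ⟨x, hx⟩).trans le_sup_right
    · exact (le_iSup (fun x : {x : OneMatrixIndex L // ¬IsTopL0 x} => tradedFam θ a b Q x.1)
        ⟨x, hx⟩).trans le_sup_left
  -- Modular law: the first sum lies in the kernel, and its complement meets the kernel only in `0`.
  have h := sup_inf_assoc_of_le
    (⨆ x : {x : OneMatrixIndex L // IsTopL0 x}, oneMatrixFam a b x.1) hle
  rw [htop, top_inf_eq, iSup_isTopL0_inf_ker hab, sup_bot_eq] at h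
  exact h.symm

/-! ### The freedom and fiber prebases -/

/-- Passing from the indexed family to its set of nonzero members preserves independence and
discards nothing from the span. -/
theorem isPrebasis_tradedFam (hQ : ∀ l k i h, l = L → h = 0 → Q l k i h)
    (hab : IsFlowPrebasis θ a b) :
    IsPrebasis {X | X ≠ ⊥ ∧ ∃ x : OneMatrixIndex L, ¬IsTopL0 x ∧ X = tradedFam θ a b Q x}
      (LinearMap.ker (diffMap θ).toLinearMap) := by
  constructor
  · refine (iSupIndep_tradedFam Q hab).sSupIndep_range.mono ?_
    rintro _ ⟨-, x, -, rfl⟩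
    exact ⟨x, rfl⟩
  · rw [← iSup_tradedFam_eq_ker Q hQ hab]
    apply le_antisymm
    · refine sSup_le ?_
      rintro _ ⟨-, x, hx, rfl⟩
      exact le_iSup (fun x : {x : OneMatrixIndex L // ¬IsTopL0 x} => tradedFam θ a b Q x.1) ⟨x, hx⟩
    · refine iSup_le fun x => ?_
      by_cases h0 : tradedFam θ a b Q x.1 = ⊥
      · rw [h0]; exact bot_le
      · exact le_sSup ⟨h0, x.1, x.2, rfl⟩

/-- The members of the family `tradedFam θ a b Q` as one-matrix and two-matrix subspaces. -/
theorem oneMatrixSet_union_twoMatrixSet (hQ : ∀ l k i h, l = L → h = 0 → Q l k i h)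
    (P : ℕ → ℕ → ℕ → ℕ → ℕ → Prop)
    (hP : ∀ l k n i h, n + 1 ≤ l → l ≤ L → i ≤ n + 1 → n ≤ k → k ≤ L → h ≤ n →
      (P l k (n + 1) i h ↔ ¬(l = L ∧ h = 0) ∧ ¬(Q l k i h ∧ n + 1 < l ∧ n + 1 ≤ k))) :
    oneMatrixSet a b P ∪ twoMatrixSet θ a b (fun l k _ i h => Q l k i h) =
      {X | X ≠ ⊥ ∧ ∃ x : OneMatrixIndex L, ¬IsTopL0 x ∧ X = tradedFam θ a b Q x} := by
  ext X
  constructor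
  · rintro (⟨h0, l, k, n, i, h, hn, hnl, hl, hi, hnk, hk, hh, hp, rfl⟩ |
      ⟨h0, l, k, n, i, h, hn, hnl, hl, hh, hnk, hk, hi, hq, rfl⟩)
    · rw [hP l k n i h hnl hl hi hnk hk hh] at hp
      refine ⟨h0, ⟨⟨n, hn⟩, (⟨l, hnl, hl⟩, ⟨i, hi⟩), (⟨k, hnk, hk⟩, ⟨h, hh⟩)⟩,
        fun ht => hp.1 ⟨ht.1, ht.2.1⟩, ?_⟩
      rw [tradedFam, dif_neg hp.2]
      rfl
    · refine ⟨h0, ⟨⟨n, Nat.lt_of_succ_lt hn⟩, (⟨l, hnl.le, hl⟩, ⟨i, hi⟩),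
        (⟨k, (Nat.le_succ n).trans hnk, hk⟩, ⟨h, Nat.le_of_lt_succ hh⟩)⟩,
        fun ht => ht.2.2 ⟨hnl, hnk⟩, ?_⟩
      rw [tradedFam, dif_pos ⟨hq, hnl, hnk⟩]
  · rintro ⟨h0, ⟨⟨n, hn⟩, ⟨⟨l, hnl, hl⟩, ⟨i, hi⟩⟩, ⟨⟨k, hnk, hk⟩, ⟨h, hh⟩⟩⟩, hx, rfl⟩
    rw [tradedFam] at h0 ⊢
    split_ifs at h0 ⊢ with hQ'
    · exact Or.inr ⟨h0, l, k, n, i, h, hQ'.2.1.trans_le hl, hQ'.2.1, hl, Nat.lt_succ_of_le hh,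
        hQ'.2.2, hk, hi, hQ'.1, rfl⟩
    · refine Or.inl ⟨h0, l, k, n, i, h, hn, hnl, hl, hi, hnk, hk, hh, ?_, rfl⟩
      rw [hP l k n i h hnl hl hi hnk hk hh]
      -- An index with `l = L`, `h = 0` that is not exchanged is exceptional, contrary to `hx`.
      exact ⟨fun ht => hx ⟨ht.1, ht.2, fun ht' => hQ' ⟨hQ _ _ _ _ ht.1 ht.2, ht'⟩⟩, hQ'⟩

end Traded

/-! ### Reading the two prebases as exchanged families -/

section Sets

variable {L : ℕ} {d : ℕ → ℕ} {θ : WeightSpace L d} {a b : LayerFamily d}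

/-- The difference removes subspaces, not indices. The two agree because independence makes nonzero
`φ` with different indices different subspaces. -/
theorem oneMatrixSet_diff (hab : IsFlowPrebasis θ a b) (P P' : ℕ → ℕ → ℕ → ℕ → ℕ → Prop) :
    (oneMatrixSet a b P \ oneMatrixSet a b P' : Set (Submodule ℝ (WeightSpace L d))) =
      oneMatrixSet a b fun l k j i h => P l k j i h ∧ ¬P' l k j i h := by
  ext X
  constructor
  · rintro ⟨⟨h0, l, k, n, i, h, hn, hnl, hl, hi, hnk, hk, hh, hp, rfl⟩, hX⟩
    exact ⟨h0, l, k, n, i, h, hn, hnl, hl, hi, hnk, hk, hh,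
      ⟨hp, fun hp' => hX ⟨h0, l, k, n, i, h, hn, hnl, hl, hi, hnk, hk, hh, hp', rfl⟩⟩, rfl⟩
  · rintro ⟨h0, l, k, n, i, h, hn, hnl, hl, hi, hnk, hk, hh, hp, rfl⟩
    refine ⟨⟨h0, l, k, n, i, h, hn, hnl, hl, hi, hnk, hk, hh, hp.1, rfl⟩, ?_⟩
    rintro ⟨h0', l', k', n', i', h', hn', hnl', hl', hi', hnk', hk', hh', hp', heq⟩
    let x : OneMatrixIndex L := ⟨⟨n, hn⟩, (⟨l, hnl, hl⟩, ⟨i, hi⟩), (⟨k, hnk, hk⟩, ⟨h, hh⟩)⟩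
    let x' : OneMatrixIndex L :=
      ⟨⟨n', hn'⟩, (⟨l', hnl', hl'⟩, ⟨i', hi'⟩), (⟨k', hnk', hk'⟩, ⟨h', hh'⟩)⟩
    have hx : oneMatrixFam a b x = oneMatrixFam a b x' := heq
    have hxx : x = x' := (iSupIndep_oneMatrixFam_and_iSup hab).1.injOn h0
      (show oneMatrixFam a b x' ≠ ⊥ from hx ▸ h0) hx
    have h1 : n = n' := congrArg (fun y : OneMatrixIndex L => (y.1 : ℕ)) hxx
    have h2 : l = l' := congrArg (fun y : OneMatrixIndex L => (y.2.1.1 : ℕ)) hxx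
    have h3 : i = i' := congrArg (fun y : OneMatrixIndex L => (y.2.1.2 : ℕ)) hxx
    have h4 : k = k' := congrArg (fun y : OneMatrixIndex L => (y.2.2.1 : ℕ)) hxx
    have h5 : h = h' := congrArg (fun y : OneMatrixIndex L => (y.2.2.2 : ℕ)) hxx
    rw [← h1, ← h2, ← h3, ← h4, ← h5] at hp'
    exact hp.2 hp'

theorem oneMatrixSet_union (P P' : ℕ → ℕ → ℕ → ℕ → ℕ → Prop) :
    (oneMatrixSet a b P ∪ oneMatrixSet a b P' : Set (Submodule ℝ (WeightSpace L d))) =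
      oneMatrixSet a b fun l k j i h => P l k j i h ∨ P' l k j i h := by
  ext X
  constructor
  · rintro (⟨h0, l, k, n, i, h, hn, hnl, hl, hi, hnk, hk, hh, hp, rfl⟩ |
      ⟨h0, l, k, n, i, h, hn, hnl, hl, hi, hnk, hk, hh, hp, rfl⟩)
    · exact ⟨h0, l, k, n, i, h, hn, hnl, hl, hi, hnk, hk, hh, Or.inl hp, rfl⟩
    · exact ⟨h0, l, k, n, i, h, hn, hnl, hl, hi, hnk, hk, hh, Or.inr hp, rfl⟩
  · rintro ⟨h0, l, k, n, i, h, hn, hnl, hl, hi, hnk, hk, hh, hp | hp, rfl⟩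
    · exact Or.inl ⟨h0, l, k, n, i, h, hn, hnl, hl, hi, hnk, hk, hh, hp, rfl⟩
    · exact Or.inr ⟨h0, l, k, n, i, h, hn, hnl, hl, hi, hnk, hk, hh, hp, rfl⟩

theorem twoMatrixSet_union (P P' : ℕ → ℕ → ℕ → ℕ → ℕ → Prop) :
    twoMatrixSet θ a b P ∪ twoMatrixSet θ a b P' =
      twoMatrixSet θ a b fun l k j i h => P l k j i h ∨ P' l k j i h := by
  ext X
  constructor
  · rintro (⟨h0, l, k, n, i, h, hn, hnl, hl, hh, hnk, hk, hi, hp, rfl⟩ |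
      ⟨h0, l, k, n, i, h, hn, hnl, hl, hh, hnk, hk, hi, hp, rfl⟩)
    · exact ⟨h0, l, k, n, i, h, hn, hnl, hl, hh, hnk, hk, hi, Or.inl hp, rfl⟩
    · exact ⟨h0, l, k, n, i, h, hn, hnl, hl, hh, hnk, hk, hi, Or.inr hp, rfl⟩
  · rintro ⟨h0, l, k, n, i, h, hn, hnl, hl, hh, hnk, hk, hi, hp | hp, rfl⟩
    · exact Or.inl ⟨h0, l, k, n, i, h, hn, hnl, hl, hh, hnk, hk, hi, hp, rfl⟩
    · exact Or.inr ⟨h0, l, k, n, i, h, hn, hnl, hl, hh, hnk, hk, hi, hp, rfl⟩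

theorem isPrebasis_thetaFree (hab : IsFlowPrebasis θ a b) :
    IsPrebasis (thetaFree θ a b) (LinearMap.ker (diffMap θ).toLinearMap) := by
  have hQ : ∀ l k i h : ℕ, l = L → h = 0 → (fun l _ _ h => l = L ∧ h = 0) l k i h :=
    fun _ _ _ _ h1 h2 => ⟨h1, h2⟩
  rw [thetaFree, thetaO, thetaOL0, thetaTL0, oneMatrixSet_diff hab,
    oneMatrixSet_union_twoMatrixSet (fun l _ _ h => l = L ∧ h = 0) hQ]
  · exact isPrebasis_tradedFam _ hQ hab
  · intro l k n i h _ _ _ _ _ _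
    tauto

theorem isPrebasis_thetaFiber (hab : IsFlowPrebasis θ a b) :
    IsPrebasis (thetaFiber θ a b) (LinearMap.ker (diffMap θ).toLinearMap) := by
  have hQ : ∀ l k i h : ℕ, l = L → h = 0 →
      (fun l k i h => (l = L ∧ h = 0) ∨ (k < l ∧ h < i)) l k i h :=
    fun _ _ _ _ h1 h2 => Or.inl ⟨h1, h2⟩
  rw [thetaFiber, thetaStratum, thetaO, thetaOL0, thetaOComb, thetaTL0, thetaTComb,
    oneMatrixSet_diff hab, oneMatrixSet_diff hab, Set.union_assoc (oneMatrixSet a b _),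
    twoMatrixSet_union, Set.union_right_comm, oneMatrixSet_union,
    oneMatrixSet_union_twoMatrixSet (fun l k i h => (l = L ∧ h = 0) ∨ (k < l ∧ h < i)) hQ]
  · exact isPrebasis_tradedFam _ hQ hab
  · intro l k n i h _ _ _ _ _ _
    simp only [true_and]
    -- A `φ` with `k < l`, `h < i` and no `τ` has `l = j` or `k = j - 1`; as `k < l`, both cases
    -- give `j = k + 1`, so these are exactly the members added to the stratum prebasis.
    omega

end Sets

theorem mainTheorem5 (L : ℕ) (d : ℕ → ℕ) (θ : WeightSpace L d) :
    (∀ a b : LayerFamily d, IsFlowPrebasis θ a b →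
      IsPrebasis (thetaFree θ a b) (LinearMap.ker (diffMap θ).toLinearMap) ∧
      IsPrebasis (thetaFiber θ a b) (LinearMap.ker (diffMap θ).toLinearMap)) ∧
    (Module.finrank ℝ (LinearMap.ker (diffMap θ).toLinearMap) : ℤ) =
      ∑ j ∈ Finset.Icc 1 L, (d j : ℤ) * (d (j - 1) : ℤ)
      - ∑ j ∈ Finset.Icc 1 L,
          ((subseqMat θ L j).rank : ℤ) * ((subseqMat θ (j - 1) 0).rank : ℤ)
      + ∑ j ∈ Finset.Icc 1 (L - 1),
          ((subseqMat θ L j).rank : ℤ) * ((subseqMat θ j 0).rank : ℤ) :=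
  ⟨fun _ _ hab => ⟨isPrebasis_thetaFree hab, isPrebasis_thetaFiber hab⟩, finrank_ker_diffMap θ⟩
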